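/- Consider vectors of $n$ qubits, i.e. elements of $(\mathbb{C}^2)^{\otimes n}$. A \emph{tree} is a rooted tree of $\otimes$ and $+$ gates whose leaves are labelled by a qubit $i$ together with a (not necessarily normalized) single-qubit vector $\alpha|0\rangle+\beta|1\rangle$, such that the inputs of each $+$ gate are vectors of the same set of qubits and the inputs of each $\otimes$ gate are vectors of pairwise disjoint sets of qubits; its size is its number of leaves. The \emph{tree size} $\mathrm{TS}(|\Psi\rangle)$ is the minimum size of a tree that describes $|\Psi\rangle$. A three-qubit vector is in the \emph{W class} if it equals $A_1\otimes A_2\otimes A_3\,|W\rangle$ for some invertible $2\times 2$ complex matrices $A_1,A_2,A_3$, where $|W\rangle=\frac{1}{\sqrt3}(|001\rangle+|010\rangle+|100\rangle)$. A four-qubit vector $|\Psi\rangle$ has the \emph{irreducible $A|BCD$ form} if for every qubit $A\in\{1,2,3,4\}$ and every invertible operator $A_1$ acting on that qubit, when the resulting vector is written as $A_1|\Psi\rangle=|0\rangle_A|\phi_0\rangle_{BCD}+|1\rangle_A|\phi_1\rangle_{BCD}$, both $|\phi_0\rangle$ and $|\phi_1\rangle$ are in the W class. Let pure states be represented by nonzero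 vectors. Then a four-qubit pure state has the maximal tree size among all four-qubit pure states if and only if it has the irreducible $A|BCD$ form. The maximal tree size of four-qubit pure states is $16$, and it is attained by the normalized state $$|\Psi^{(4)}\rangle=\sqrt{\tfrac13}\Big[\tfrac12\big(|0110\rangle+|0101\rangle+|1001\rangle+|1010\rangle\big)-|0011\rangle-|1100\rangle\Big].$$ -/

import Mathlib

/-- Vectors of `n` qubits, given by their amplitudes in the computational basis. -/
abbrev QState (n : ℕ) : Type := (Fin n → Fin 2) → ℂ

/-- The computational basis vector `|x⟩`. -/
def ket {n : ℕ} (x : Fin n → Fin 2) : QState n := Pi.single x 1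

/-- Rooted trees of `⊗` and `+` gates on qubits `0, …, n - 1`. A leaf carries a qubit `i` and an
arbitrary (not necessarily normalized) single-qubit vector `v 0 |0⟩ + v 1 |1⟩`. Gates are binary;
a gate with more inputs is a nest of binary ones, with the same leaves. -/
inductive QTree (n : ℕ) : Type
  | leaf (i : Fin n) (v : Fin 2 → ℂ) : QTree n
  | plus (s t : QTree n) : QTree n
  | tensor (s t : QTree n) : QTree n

namespace QTree

/-- The set of qubits that occur in a tree. -/
def qubits {n : ℕ} : QTree n → Finset (Fin n)
  | leaf i _ => {i}
  | plus s t => s.qubits ∪ t.qubits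
  | tensor s t => s.qubits ∪ t.qubits

/-- A tree is well formed if the two inputs of each `+` gate are vectors of the same qubits, and
the two inputs of each `⊗` gate are vectors of disjoint sets of qubits. -/
def WellFormed {n : ℕ} : QTree n → Prop
  | leaf _ _ => True
  | plus s t => s.WellFormed ∧ t.WellFormed ∧ s.qubits = t.qubits
  | tensor s t => s.WellFormed ∧ t.WellFormed ∧ Disjoint s.qubits t.qubits

/-- The amplitude, at the basis vector `|x⟩`, of the vector computed by a tree (for a well-formed
tree it depends only on the bits `x i` with `i` among the qubits of the tree). -/
def amplitude {n : ℕ} : QTree n → (Fin n → Fin 2) → ℂ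
  | leaf i v, x => v (x i)
  | plus s t, x => s.amplitude x + t.amplitude x
  | tensor s t, x => s.amplitude x * t.amplitude x

/-- The size of a tree is its number of leaves. -/
def size {n : ℕ} : QTree n → ℕ
  | leaf _ _ => 1
  | plus s t => s.size + t.size
  | tensor s t => s.size + t.size

/-- The tree `t` describes the `n`-qubit vector `ψ`. -/
def Describes {n : ℕ} (t : QTree n) (ψ : QState n) : Prop :=
  t.WellFormed ∧ t.qubits = Finset.univ ∧ t.amplitude = ψ

end QTree

/-- The tree size of `ψ`: the minimum size of the trees that describe `ψ`
(with value `⊤` if there were none). -/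
noncomputable def treeSize {n : ℕ} (ψ : QState n) : ℕ∞ :=
  ⨅ (t : QTree n) (_ : t.Describes ψ), (t.size : ℕ∞)

/-- The operator `A 0 ⊗ A 1 ⊗ ⋯ ⊗ A (n - 1)` applied to `ψ`. -/
noncomputable def tensorOp {n : ℕ} (A : Fin n → Matrix (Fin 2) (Fin 2) ℂ) (ψ : QState n) :
    QState n :=
  fun x => ∑ y : Fin n → Fin 2, (∏ i, A i (x i) (y i)) * ψ y

/-- The operator that acts as `A` on qubit `i`, and as the identity on the others, applied
to `ψ`. -/
noncomputable def localOp {n : ℕ} (i : Fin n) (A : Matrix (Fin 2) (Fin 2) ℂ) (ψ : QState n) :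
    QState n :=
  fun x => ∑ b : Fin 2, A (x i) b * ψ (Function.update x i b)

/-- The three-qubit state `|W⟩ = (|001⟩ + |010⟩ + |100⟩) / √3`. -/
noncomputable def wState : QState 3 :=
  (1 / (Real.sqrt 3 : ℂ)) • (ket ![0, 0, 1] + ket ![0, 1, 0] + ket ![1, 0, 0])

/-- The W class: the images of `|W⟩` under invertible local operators. -/
def IsWClass (φ : QState 3) : Prop :=
  ∃ A : Fin 3 → GL (Fin 2) ℂ, φ = tensorOp (fun i => (A i : Matrix (Fin 2) (Fin 2) ℂ)) wState

/-- The three-qubit components `φ₀, φ₁` (for `b = 0, 1`) of the `A|BCD` form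
`ψ = |0⟩ φ₀ + |1⟩ φ₁`, where the first factor is qubit `a` and the second one consists of the other
three qubits in increasing order. -/
def component (a : Fin 4) (b : Fin 2) (ψ : QState 4) : QState 3 :=
  fun y => ψ (Fin.insertNth (α := fun _ => Fin 2) a b y)

/-- The irreducible `A|BCD` form: for each choice of the qubit `A`, after any invertible operator
on that qubit, both components of the `A|BCD` form are in the W class. -/
def HasIrreducibleForm (ψ : QState 4) : Prop :=
  ∀ (a : Fin 4) (A : GL (Fin 2) ℂ) (b : Fin 2),
    IsWClass (component a b (localOp a (A : Matrix (Fin 2) (Fin 2) ℂ) ψ))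

/-- The four-qubit state `|Ψ⁽⁴⁾⟩`. -/
noncomputable def psiFour : QState 4 :=
  (Real.sqrt (1 / 3) : ℂ) •
    ((1 / 2 : ℂ) • (ket ![0, 1, 1, 0] + ket ![0, 1, 0, 1] + ket ![1, 0, 0, 1] + ket ![1, 0, 1, 0])
      - ket ![0, 0, 1, 1] - ket ![1, 1, 0, 0])

/-! A three-qubit vector is a pencil of 2×2 matrices, and its hyperdeterminant is the discriminant
of the determinant of that pencil. If it is nonzero, two members of the pencil have rank one and the
vector is a sum of two products (6 leaves). If it vanishes, either a qubit factors off (5 leaves),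
or the vector is `u⊗q⊗r + p⊗v⊗r + p⊗q⊗w` in general position, which is the W class (8 leaves, and no
fewer).

The irreducible form says that every contraction of one qubit by a nonzero functional is W
(`hasIrreducibleForm_iff`). If some contraction is not W, expanding in a suitable basis of that
qubit costs at most 15 leaves (`hasTree_of_not_irreducible`).

Conversely, when a summand of an irreducible vector splits off a qubit in state `v`, a functional
that kills `v` turns the other summands into a W vector. With 15 leaves or fewer those summands are
always too simple for that (`HasIrreducibleForm.le_size`).

For the bound 16, contract qubit 0 by `α`. On each other qubit, the functional that kills the base
point (`p`, `q` or `r`) of the resulting tangent vector can be chosen linear and invertible in `α`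
(`exists_isotropic_map`). After these three changes of variable, the symmetrization over any three
qubits including qubit 0 vanishes, so the vector is a combination of two pairings into singlets
(`exists_singlet_pairs`). Each pairing is a product of two two-qubit vectors, of 4 leaves each. -/

/-! ### Contractions, the W class and tangent vectors -/

/-- The contraction of qubit `a` of `ψ` with the functional `c`. -/
def contr {n : ℕ} (a : Fin (n + 1)) (c : Fin 2 → ℂ) (ψ : QState (n + 1)) : QState n :=
  fun y => ∑ b, c b * ψ (Fin.insertNth (α := fun _ => Fin 2) a b y)

/-- `f` is the product of a vector of qubit `i` and a vector of the other qubits. -/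
def HasFactor {n : ℕ} (i : Fin n) (f : QState n) : Prop :=
  ∃ (v : Fin 2 → ℂ) (g : QState n), (∀ x b, g (Function.update x i b) = g x) ∧
    ∀ x, f x = v (x i) * g x

/-- The determinant of the matrix of amplitudes of a two-qubit vector. -/
def pairDet (χ : QState 2) : ℂ := χ ![0, 0] * χ ![1, 1] - χ ![0, 1] * χ ![1, 0]

/-- The determinant of two vectors of the plane. -/
def det2 (p q : Fin 2 → ℂ) : ℂ := p 0 * q 1 - p 1 * q 0

/-- Cayley's hyperdeterminant. -/
def hyperdet (φ : QState 3) : ℂ :=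
  (φ ![0, 0, 0] * φ ![1, 1, 1] + φ ![1, 0, 0] * φ ![0, 1, 1]
    - φ ![0, 0, 1] * φ ![1, 1, 0] - φ ![1, 0, 1] * φ ![0, 1, 0]) ^ 2
  - 4 * (φ ![0, 0, 0] * φ ![0, 1, 1] - φ ![0, 0, 1] * φ ![0, 1, 0])
    * (φ ![1, 0, 0] * φ ![1, 1, 1] - φ ![1, 0, 1] * φ ![1, 1, 0])

/-- `φ` is a sum of two product vectors. -/
def IsTwoProducts (φ : QState 3) : Prop :=
  ∃ p q r p' q' r' : Fin 2 → ℂ, ∀ i j k,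
    φ ![i, j, k] = p i * q j * r k + p' i * q' j * r' k

/-- `φ` is a tangent vector, in general position, of the variety of product vectors. -/
def IsTangent (φ : QState 3) : Prop :=
  ∃ p u q v r w : Fin 2 → ℂ, det2 p u ≠ 0 ∧ det2 q v ≠ 0 ∧ det2 r w ≠ 0 ∧ ∀ i j k,
    φ ![i, j, k] = u i * q j * r k + p i * v j * r k + p i * q j * w k

theorem vec3_eta (x : Fin 3 → Fin 2) : ![x 0, x 1, x 2] = x := by
  ext i; fin_cases i <;> rfl

theorem vec4_eta (x : Fin 4 → Fin 2) : ![x 0, x 1, x 2, x 3] = x := by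
  ext i; fin_cases i <;> rfl

theorem insertNth_two (i a b : Fin 2) :
    Fin.insertNth (α := fun _ => Fin 2) (0 : Fin 3) i ![a, b] = ![i, a, b] ∧
    Fin.insertNth (α := fun _ => Fin 2) (1 : Fin 3) i ![a, b] = ![a, i, b] ∧
    Fin.insertNth (α := fun _ => Fin 2) (2 : Fin 3) i ![a, b] = ![a, b, i] := by
  refine ⟨?_, ?_, ?_⟩ <;> ext j <;> fin_cases j <;> rfl

theorem insertNth_three (i a b c : Fin 2) :
    Fin.insertNth (α := fun _ => Fin 2) (0 : Fin 4) i ![a, b, c] = ![i, a, b, c] ∧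
    Fin.insertNth (α := fun _ => Fin 2) (1 : Fin 4) i ![a, b, c] = ![a, i, b, c] ∧
    Fin.insertNth (α := fun _ => Fin 2) (2 : Fin 4) i ![a, b, c] = ![a, b, i, c] ∧
    Fin.insertNth (α := fun _ => Fin 2) (3 : Fin 4) i ![a, b, c] = ![a, b, c, i] := by
  refine ⟨?_, ?_, ?_, ?_⟩ <;> ext j <;> fin_cases j <;> rfl

theorem contr_zero_apply (c : Fin 2 → ℂ) (φ : QState 3) (j k : Fin 2) :
    contr 0 c φ ![j, k] = c 0 * φ ![0, j, k] + c 1 * φ ![1, j, k] := by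
  simp only [contr, Fin.sum_univ_two, (insertNth_two _ j k).1]

theorem contr_one_apply (c : Fin 2 → ℂ) (φ : QState 3) (j k : Fin 2) :
    contr 1 c φ ![j, k] = c 0 * φ ![j, 0, k] + c 1 * φ ![j, 1, k] := by
  simp only [contr, Fin.sum_univ_two, (insertNth_two _ j k).2.1]

theorem contr_two_apply (c : Fin 2 → ℂ) (φ : QState 3) (j k : Fin 2) :
    contr 2 c φ ![j, k] = c 0 * φ ![j, k, 0] + c 1 * φ ![j, k, 1] := by
  simp only [contr, Fin.sum_univ_two, (insertNth_two _ j k).2.2]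

theorem component_localOp (a : Fin 4) (b : Fin 2) (A : Matrix (Fin 2) (Fin 2) ℂ) (ψ : QState 4) :
    component a b (localOp a A ψ) = contr a (A b) ψ := by
  ext y
  simp [component, localOp, contr, Fin.update_insertNth]

theorem exists_GL_row (c : Fin 2 → ℂ) (hc : c ≠ 0) :
    ∃ A : GL (Fin 2) ℂ, (A : Matrix (Fin 2) (Fin 2) ℂ) 0 = c := by
  by_cases h : c 0 = 0
  · have h1 : c 1 ≠ 0 := fun h1 => hc (by ext i; fin_cases i <;> assumption)
    refine ⟨Matrix.GeneralLinearGroup.mkOfDetNeZero !![c 0, c 1; 1, 0] ?_, ?_⟩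
    · simpa [Matrix.det_fin_two] using h1
    · ext i; fin_cases i <;> rfl
  · refine ⟨Matrix.GeneralLinearGroup.mkOfDetNeZero !![c 0, c 1; 0, 1] ?_, ?_⟩
    · simpa [Matrix.det_fin_two] using h
    · ext i; fin_cases i <;> rfl

theorem GL_row_ne_zero (A : GL (Fin 2) ℂ) (b : Fin 2) :
    (A : Matrix (Fin 2) (Fin 2) ℂ) b ≠ 0 := by
  intro h
  have hd : (A : Matrix (Fin 2) (Fin 2) ℂ).det ≠ 0 := by
    have := A.isUnit
    rw [Matrix.isUnit_iff_isUnit_det] at this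
    exact this.ne_zero
  exact hd (Matrix.det_eq_zero_of_row_eq_zero b (fun j => congrFun h j))

/-- The components after a local operator are the contractions by its rows, and the rows of
invertible matrices are exactly the nonzero functionals. -/
theorem hasIrreducibleForm_iff (ψ : QState 4) :
    HasIrreducibleForm ψ ↔ ∀ (a : Fin 4) (c : Fin 2 → ℂ), c ≠ 0 → IsWClass (contr a c ψ) := by
  constructor
  · intro h a c hc
    obtain ⟨A, hA⟩ := exists_GL_row c hc
    have := h a A 0
    rwa [component_localOp, hA] at this
  · intro h a A b
    rw [component_localOp]
    exact h a _ (GL_row_ne_zero A b)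

theorem tensorOp_wState (A : Fin 3 → Matrix (Fin 2) (Fin 2) ℂ) (x : Fin 3 → Fin 2) :
    tensorOp A wState x = (1 / (Real.sqrt 3 : ℂ)) *
      (A 0 (x 0) 0 * A 1 (x 1) 0 * A 2 (x 2) 1 + A 0 (x 0) 0 * A 1 (x 1) 1 * A 2 (x 2) 0
        + A 0 (x 0) 1 * A 1 (x 1) 0 * A 2 (x 2) 0) := by
  simp only [tensorOp, wState, Pi.smul_apply, Pi.add_apply, ket, smul_eq_mul, Pi.single_apply,
    mul_add, Finset.sum_add_distrib, mul_ite, mul_one, mul_zero, Finset.sum_ite_eq',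
    Finset.mem_univ, if_true, Fin.prod_univ_three]
  simp
  ring

theorem sqrt_three_ne : (Real.sqrt 3 : ℂ) ≠ 0 := by
  rw [Ne, Complex.ofReal_eq_zero]; positivity

/-- Column 0 of each local operator is the base point and column 1 the direction; the normalization
of `wState` is absorbed into the first qubit. -/
theorem isWClass_iff_isTangent (φ : QState 3) : IsWClass φ ↔ IsTangent φ := by
  constructor
  · rintro ⟨A, rfl⟩
    have hd : ∀ i, det2 (fun j => (A i).1 j 0) (fun j => (A i).1 j 1) ≠ 0 := by
      intro i
      have := (A i).isUnit
      rw [Matrix.isUnit_iff_isUnit_det] at this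
      have := this.ne_zero
      rw [Matrix.det_fin_two] at this
      intro h; apply this; simp only [det2] at h; linear_combination h
    refine ⟨fun j => (1 / (Real.sqrt 3 : ℂ)) * (A 0).1 j 0, fun j => (1 / (Real.sqrt 3 : ℂ)) * (A 0).1 j 1,
      _, _, _, _, ?_, hd 1, hd 2, ?_⟩
    · have h3 := sqrt_three_ne
      have : (1 / (Real.sqrt 3 : ℂ)) ^ 2 * det2 (fun j => (A 0).1 j 0) (fun j => (A 0).1 j 1) ≠ 0 :=
        mul_ne_zero (pow_ne_zero 2 (one_div_ne_zero h3)) (hd 0)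
      intro h; apply this; simp only [det2] at h ⊢; linear_combination h
    · intro i j k
      rw [tensorOp_wState]
      simp
      ring
  · rintro ⟨p, u, q, v, r, w, h0, h1, h2, h⟩
    have h3 := sqrt_three_ne
    refine ⟨![Matrix.GeneralLinearGroup.mkOfDetNeZero
          !![Real.sqrt 3 * p 0, Real.sqrt 3 * u 0; Real.sqrt 3 * p 1, Real.sqrt 3 * u 1] ?_,
        Matrix.GeneralLinearGroup.mkOfDetNeZero !![q 0, v 0; q 1, v 1] ?_,
        Matrix.GeneralLinearGroup.mkOfDetNeZero !![r 0, w 0; r 1, w 1] ?_], ?_⟩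
    · rw [Matrix.det_fin_two]
      have := mul_ne_zero (mul_ne_zero h3 h3) h0
      intro h; apply this; simp only [det2]; simp at h; linear_combination h
    · rw [Matrix.det_fin_two]
      intro h; apply h1; simp only [det2]; simp at h; linear_combination h
    · rw [Matrix.det_fin_two]
      intro h; apply h2; simp only [det2]; simp at h; linear_combination h
    · ext x
      rw [tensorOp_wState, ← vec3_eta x, h]
      have e : ∀ (a b c d : ℂ) (i : Fin 2), !![a, b; c, d] i 0 = ![a, c] i ∧
          !![a, b; c, d] i 1 = ![b, d] i := by
        intro a b c d i; fin_cases i <;> simp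
      have e2 : ∀ (p : Fin 2 → ℂ) (i : Fin 2), ![p 0, p 1] i = p i := by
        intro p i; fin_cases i <;> simp
      have e3 : ∀ (p : Fin 2 → ℂ) (s : ℂ) (i : Fin 2), ![s * p 0, s * p 1] i = s * p i := by
        intro p s i; fin_cases i <;> simp
      simp [Matrix.GeneralLinearGroup.mkOfDetNeZero, e, e2, e3]
      field_simp
      ring

/-! ### Binary quadratic forms and 2×2 matrices -/

theorem exists_sq_eq (z : ℂ) : ∃ s : ℂ, s ^ 2 = z :=
  IsAlgClosed.exists_pow_nat_eq z two_pos

theorem fin_two_ne_zero {k : Fin 2 → ℂ} (hk : k ≠ 0) : k 0 ≠ 0 ∨ k 1 ≠ 0 := by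
  by_contra! h
  exact hk (by ext i; fin_cases i <;> simp [h.1, h.2])

theorem exists_det2_eq_one {k : Fin 2 → ℂ} (hk : k ≠ 0) : ∃ l : Fin 2 → ℂ, det2 k l = 1 := by
  rcases fin_two_ne_zero hk with h | h
  · exact ⟨![0, 1 / k 0], by simp [det2, h]⟩
  · exact ⟨![-1 / k 1, 0], by simp [det2]; field_simp⟩

theorem ne_zero_of_det2_left {p q : Fin 2 → ℂ} (h : det2 p q ≠ 0) : p ≠ 0 := by
  rintro rfl; simp [det2] at h

theorem exists_smul_of_det2 {r x : Fin 2 → ℂ} (hr : r ≠ 0) (h : det2 r x = 0) :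
    ∃ t : ℂ, ∀ i, x i = t * r i := by
  simp only [det2] at h
  rcases fin_two_ne_zero hr with h0 | h0
  · refine ⟨x 0 / r 0, fun i => ?_⟩
    fin_cases i
    · simp; field_simp
    · simp; field_simp; linear_combination h
  · refine ⟨x 1 / r 1, fun i => ?_⟩
    fin_cases i
    · simp; field_simp; linear_combination -h
    · simp; field_simp

theorem exists_common_of_det2 {p q : Fin 2 → ℂ} (h : det2 p q = 0) :
    ∃ (e : Fin 2 → ℂ) (s t : ℂ), (∀ i, p i = s * e i) ∧ ∀ i, q i = t * e i := by
  by_cases hp : p = 0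
  · exact ⟨q, 0, 1, by simp [hp], by simp⟩
  · obtain ⟨t, ht⟩ := exists_smul_of_det2 hp h
    exact ⟨p, 1, t, by simp, ht⟩

theorem exists_rank_one {M : Fin 2 → Fin 2 → ℂ} (h : det2 (M 0) (M 1) = 0) :
    ∃ q r : Fin 2 → ℂ, ∀ i j, M i j = q i * r j := by
  obtain ⟨e, s, t, hs, ht⟩ := exists_common_of_det2 h
  refine ⟨![s, t], e, fun i j => ?_⟩
  fin_cases i
  · simpa using hs j
  · simpa using ht j

theorem exists_binary_root (a b c : ℂ) :
    ∃ k : Fin 2 → ℂ, k ≠ 0 ∧ a * k 0 ^ 2 + b * k 0 * k 1 + c * k 1 ^ 2 = 0 := by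
  by_cases ha : a = 0
  · refine ⟨![1, 0], fun h => by simpa using congrFun h 0, by simp [ha]⟩
  · obtain ⟨s, hs⟩ := exists_sq_eq (b ^ 2 - 4 * a * c)
    refine ⟨![-b + s, 2 * a], fun h => by simpa [ha] using congrFun h 1, ?_⟩
    simp; linear_combination a * hs

theorem exists_binary_roots {a b c : ℂ} (h : b ^ 2 - 4 * a * c ≠ 0) :
    ∃ k l : Fin 2 → ℂ, det2 k l ≠ 0 ∧ a * k 0 ^ 2 + b * k 0 * k 1 + c * k 1 ^ 2 = 0 ∧
      a * l 0 ^ 2 + b * l 0 * l 1 + c * l 1 ^ 2 = 0 := by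
  by_cases ha : a = 0
  · subst ha
    refine ⟨![1, 0], ![-c, b], ?_, ?_, ?_⟩
    · simpa [det2] using h
    · simp
    · simp; ring
  · obtain ⟨s, hs⟩ := exists_sq_eq (b ^ 2 - 4 * a * c)
    have hs0 : s ≠ 0 := by rintro rfl; apply h; rw [← hs]; ring
    refine ⟨![-b + s, 2 * a], ![-b - s, 2 * a], ?_, ?_, ?_⟩
    · have : (4 : ℂ) * a * s ≠ 0 := by simp [ha, hs0]
      intro h'; apply this; simp [det2] at h'; linear_combination h'
    · simp; linear_combination a * hs
    · simp; linear_combination a * hs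

theorem exists_kernel {a b c d : ℂ} (h : a * d - b * c = 0) :
    ∃ k : Fin 2 → ℂ, k ≠ 0 ∧ a * k 0 + b * k 1 = 0 ∧ c * k 0 + d * k 1 = 0 := by
  obtain ⟨e, s, t, hs, ht⟩ := exists_common_of_det2 (p := ![a, b]) (q := ![c, d])
    (by simpa [det2] using h)
  have h1 := hs 0; have h2 := hs 1; have h3 := ht 0; have h4 := ht 1
  simp at h1 h2 h3 h4
  by_cases he : e = 0
  · refine ⟨![1, 0], fun h => by simpa using congrFun h 0, ?_, ?_⟩ <;> simp [h1, h3, he]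
  · refine ⟨![-e 1, e 0], fun h => he ?_, ?_, ?_⟩
    · have h0 := congrFun h 0; have h1 := congrFun h 1
      simp at h0 h1
      ext i; fin_cases i <;> simp [h0, h1]
    · simp [h1, h2]; ring
    · simp [h3, h4]; ring

/-- At a double root both partial derivatives vanish; the discriminant is, up to sign, the
determinant of that linear system. -/
theorem exists_double_root {a b c : ℂ} (h : b ^ 2 - 4 * a * c = 0) :
    ∃ k : Fin 2 → ℂ, k ≠ 0 ∧ 2 * a * k 0 + b * k 1 = 0 ∧ b * k 0 + 2 * c * k 1 = 0 :=
  exists_kernel (by linear_combination -h)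

/-- A bilinear form that vanishes on a pair of vectors `(q⊥, r⊥)` is `q ⊗ w + v ⊗ r`. -/
theorem exists_tangent_pair {q r : Fin 2 → ℂ} (hq : q ≠ 0) (hr : r ≠ 0) {M : Fin 2 → Fin 2 → ℂ}
    (h : M 0 0 * q 1 * r 1 + M 1 1 * q 0 * r 0 - M 0 1 * q 1 * r 0 - M 1 0 * q 0 * r 1 = 0) :
    ∃ v w : Fin 2 → ℂ, ∀ i j, M i j = q i * w j + v i * r j := by
  obtain ⟨t, ht⟩ := exists_smul_of_det2 (x := fun j => q 0 * M 1 j - q 1 * M 0 j) hr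
    (by simp only [det2]; linear_combination h)
  rcases fin_two_ne_zero hq with h0 | h0
  · refine ⟨![0, t / q 0], fun j => M 0 j / q 0, fun i j => ?_⟩
    fin_cases i
    · simp; field_simp
    · simp; field_simp; linear_combination ht j
  · refine ⟨![-t / q 1, 0], fun j => M 1 j / q 1, fun i j => ?_⟩
    fin_cases i
    · simp; field_simp; linear_combination -ht j
    · simp; field_simp

/-! ### Classification of three-qubit vectors by the hyperdeterminant -/

theorem update_vec3 (i j k b : Fin 2) :
    Function.update ![i, j, k] 0 b = ![b, j, k] ∧ Function.update ![i, j, k] 1 b = ![i, b, k] ∧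
      Function.update ![i, j, k] 2 b = ![i, j, b] := by
  refine ⟨?_, ?_, ?_⟩ <;> ext t <;> fin_cases t <;> simp

theorem hasFactor_zero_iff (φ : QState 3) :
    HasFactor 0 φ ↔ ∃ (v : Fin 2 → ℂ) (g : Fin 2 → Fin 2 → ℂ), ∀ i j k,
      φ ![i, j, k] = v i * g j k := by
  constructor
  · rintro ⟨v, g, hg, h⟩
    refine ⟨v, fun j k => g ![0, j, k], fun i j k => ?_⟩
    rw [h, ← hg _ 0, (update_vec3 i j k 0).1]; rfl
  · rintro ⟨v, g, h⟩
    refine ⟨v, fun x => g (x 1) (x 2), fun x b => by simp, fun x => ?_⟩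
    rw [← h, vec3_eta]

theorem hasFactor_one_iff (φ : QState 3) :
    HasFactor 1 φ ↔ ∃ (v : Fin 2 → ℂ) (g : Fin 2 → Fin 2 → ℂ), ∀ i j k,
      φ ![i, j, k] = v j * g i k := by
  constructor
  · rintro ⟨v, g, hg, h⟩
    refine ⟨v, fun i k => g ![i, 0, k], fun i j k => ?_⟩
    rw [h, ← hg _ 0, (update_vec3 i j k 0).2.1]; rfl
  · rintro ⟨v, g, h⟩
    refine ⟨v, fun x => g (x 0) (x 2), fun x b => by simp, fun x => ?_⟩
    rw [← h, vec3_eta]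

theorem hasFactor_two_iff (φ : QState 3) :
    HasFactor 2 φ ↔ ∃ (v : Fin 2 → ℂ) (g : Fin 2 → Fin 2 → ℂ), ∀ i j k,
      φ ![i, j, k] = v k * g i j := by
  constructor
  · rintro ⟨v, g, hg, h⟩
    refine ⟨v, fun i j => g ![i, j, 0], fun i j k => ?_⟩
    rw [h, ← hg _ 0, (update_vec3 i j k 0).2.2]; rfl
  · rintro ⟨v, g, h⟩
    refine ⟨v, fun x => g (x 0) (x 1), fun x b => by simp, fun x => ?_⟩
    rw [← h, vec3_eta]

/-- The two distinct roots `k`, `l` of the determinant of the pencil give rank-one slices; expanding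
`φ` in the basis dual to `k`, `l` gives the two products. -/
theorem isTwoProducts_of_hyperdet {φ : QState 3} (h : hyperdet φ ≠ 0) : IsTwoProducts φ := by
  obtain ⟨k, l, hkl, hk, hl⟩ := exists_binary_roots
    (a := φ ![0, 0, 0] * φ ![0, 1, 1] - φ ![0, 0, 1] * φ ![0, 1, 0])
    (b := φ ![0, 0, 0] * φ ![1, 1, 1] + φ ![1, 0, 0] * φ ![0, 1, 1]
      - φ ![0, 0, 1] * φ ![1, 1, 0] - φ ![1, 0, 1] * φ ![0, 1, 0])
    (c := φ ![1, 0, 0] * φ ![1, 1, 1] - φ ![1, 0, 1] * φ ![1, 1, 0])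
    (by rw [hyperdet] at h; exact h)
  obtain ⟨q, r, hqr⟩ := exists_rank_one
    (M := fun i j => k 0 * φ ![0, i, j] + k 1 * φ ![1, i, j])
    (by simp only [det2]; linear_combination hk)
  obtain ⟨q', r', hqr'⟩ := exists_rank_one
    (M := fun i j => l 0 * φ ![0, i, j] + l 1 * φ ![1, i, j])
    (by simp only [det2]; linear_combination hl)
  refine ⟨![l 1 / det2 k l, -l 0 / det2 k l], q, r, ![-k 1 / det2 k l, k 0 / det2 k l], q', r',
    fun i m n => ?_⟩
  rw [mul_assoc, mul_assoc, ← hqr, ← hqr']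
  fin_cases i
  · simp; field_simp; simp only [det2]; ring
  · simp; field_simp; simp only [det2]; ring

/-- At the double root `k` the slice is `q⊗r`. The polar form of the determinant also vanishes
between `k` and a complementary `l`, so the slice at `l` is tangent to the rank-one matrices at
`q⊗r`. Any degeneracy makes a qubit factor off. -/
theorem isWClass_or_hasFactor_of_hyperdet {φ : QState 3} (h : hyperdet φ = 0) :
    IsWClass φ ∨ ∃ i, HasFactor i φ := by
  obtain ⟨k, hk, h1, h2⟩ := exists_double_root
    (a := φ ![0, 0, 0] * φ ![0, 1, 1] - φ ![0, 0, 1] * φ ![0, 1, 0])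
    (b := φ ![0, 0, 0] * φ ![1, 1, 1] + φ ![1, 0, 0] * φ ![0, 1, 1]
      - φ ![0, 0, 1] * φ ![1, 1, 0] - φ ![1, 0, 1] * φ ![0, 1, 0])
    (c := φ ![1, 0, 0] * φ ![1, 1, 1] - φ ![1, 0, 1] * φ ![1, 1, 0])
    (by rw [hyperdet] at h; exact h)
  obtain ⟨l, hkl⟩ := exists_det2_eq_one hk
  have hkl' : k 0 * l 1 - k 1 * l 0 = 1 := hkl
  obtain ⟨q, r, hqr⟩ := exists_rank_one
    (M := fun i j => k 0 * φ ![0, i, j] + k 1 * φ ![1, i, j])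
    (by simp only [det2]; linear_combination (k 0 / 2) * h1 + (k 1 / 2) * h2)
  have key : ∀ i m n, φ ![i, m, n] = (![l 1, -l 0] : Fin 2 → ℂ) i * (q m * r n) +
      (![-k 1, k 0] : Fin 2 → ℂ) i * (l 0 * φ ![0, m, n] + l 1 * φ ![1, m, n]) := by
    intro i m n
    rw [← hqr]
    fin_cases i
    · simp; linear_combination (-φ ![0, m, n]) * hkl'
    · simp; linear_combination (-φ ![1, m, n]) * hkl'
  by_cases hz : q = 0 ∨ r = 0
  · right
    refine ⟨0, (hasFactor_zero_iff φ).2 ⟨![-k 1, k 0],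
      fun m n => l 0 * φ ![0, m, n] + l 1 * φ ![1, m, n], fun i m n => ?_⟩⟩
    rw [key i m n]
    rcases hz with hz | hz <;> simp [hz]
  push Not at hz
  obtain ⟨v, w, hvw⟩ := exists_tangent_pair hz.1 hz.2
    (M := fun i j => l 0 * φ ![0, i, j] + l 1 * φ ![1, i, j]) (by
      have e00 := hqr 0 0
      have e01 := hqr 0 1
      have e10 := hqr 1 0
      have e11 := hqr 1 1
      linear_combination l 0 * h1 + l 1 * h2 - (l 0 * φ ![0, 0, 0] + l 1 * φ ![1, 0, 0]) * e11
        - (l 0 * φ ![0, 1, 1] + l 1 * φ ![1, 1, 1]) * e00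
        + (l 0 * φ ![0, 0, 1] + l 1 * φ ![1, 0, 1]) * e10
        + (l 0 * φ ![0, 1, 0] + l 1 * φ ![1, 1, 0]) * e01)
  simp only [hvw] at key
  by_cases hqv : det2 q v = 0
  · right
    obtain ⟨t, ht⟩ := exists_smul_of_det2 hz.1 hqv
    refine ⟨1, (hasFactor_one_iff φ).2 ⟨q, fun i n => (![l 1, -l 0] : Fin 2 → ℂ) i * r n +
      (![-k 1, k 0] : Fin 2 → ℂ) i * (w n + t * r n), fun i m n => ?_⟩⟩
    rw [key, ht]; ring
  by_cases hrw : det2 r w = 0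
  · right
    obtain ⟨t, ht⟩ := exists_smul_of_det2 hz.2 hrw
    refine ⟨2, (hasFactor_two_iff φ).2 ⟨r, fun i m => (![l 1, -l 0] : Fin 2 → ℂ) i * q m +
      (![-k 1, k 0] : Fin 2 → ℂ) i * (q m * t + v m), fun i m n => ?_⟩⟩
    rw [key, ht]; ring
  left
  rw [isWClass_iff_isTangent]
  refine ⟨![-k 1, k 0], ![l 1, -l 0], q, v, r, w, ?_, hqv, hrw, fun i m n => ?_⟩
  · have : det2 ![-k 1, k 0] ![l 1, -l 0] = -1 := by
      simp [det2]; linear_combination -hkl'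
    rw [this]; simp
  · rw [key]; ring

/-- As a quartic in `z`, the hyperdeterminant has leading coefficient `hyperdet φ`, and the fourth
difference over `0, …, 4` is 24 times that coefficient. -/
theorem exists_hyperdet_ne_zero (χ φ : QState 3) (h : hyperdet φ ≠ 0) :
    ∃ z : ℂ, hyperdet (fun x => χ x + z * φ x) ≠ 0 := by
  by_contra! hz
  apply h
  have h0 := hz 0
  have h1 := hz 1
  have h2 := hz 2
  have h3 := hz 3
  have h4 := hz 4
  simp only [hyperdet] at *
  linear_combination (1 / 24) * (h4 - 4 * h3 + 6 * h2 - 4 * h1 + h0)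

/-- The vanishing of the forms `c ↦ pairDet (contr i c φ)` of a tangent vector. -/
theorem IsTangent.pairDet_contr {φ : QState 3} (h : IsTangent φ) :
    ∃ p q r : Fin 2 → ℂ, p ≠ 0 ∧ q ≠ 0 ∧ r ≠ 0 ∧
      (∀ c, pairDet (contr 0 c φ) = (p 0 * c 0 + p 1 * c 1) ^ 2) ∧
      (∀ c, pairDet (contr 1 c φ) = (q 0 * c 0 + q 1 * c 1) ^ 2) ∧
      (∀ c, pairDet (contr 2 c φ) = (r 0 * c 0 + r 1 * c 1) ^ 2) := by
  obtain ⟨p, u, q, v, r, w, hp, hq, hr, h⟩ := h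
  -- For qubit 0 the determinant is `-(det2 q v * det2 r w)` times the square of `p · c`, and
  -- similarly for the others; square roots of these constants rescale the linear forms.
  obtain ⟨s, hs⟩ := exists_sq_eq (-(det2 q v * det2 r w))
  obtain ⟨t, ht⟩ := exists_sq_eq (-(det2 p u * det2 r w))
  obtain ⟨z, hz⟩ := exists_sq_eq (-(det2 p u * det2 q v))
  have aux : ∀ {s a b : ℂ}, s ^ 2 = -(a * b) → a ≠ 0 → b ≠ 0 → s ≠ 0 := by
    rintro s a b h ha hb rfl
    have : a * b = 0 := by linear_combination h
    rcases mul_eq_zero.1 this with h | h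
    exacts [ha h, hb h]
  refine ⟨s • p, t • q, z • r, smul_ne_zero (aux hs hq hr) (ne_zero_of_det2_left hp),
    smul_ne_zero (aux ht hp hr) (ne_zero_of_det2_left hq),
    smul_ne_zero (aux hz hp hq) (ne_zero_of_det2_left hr), fun c => ?_, fun c => ?_, fun c => ?_⟩
  · simp only [pairDet, contr_zero_apply, h, Pi.smul_apply, smul_eq_mul]
    simp only [det2] at hs
    linear_combination (-(p 0 * c 0 + p 1 * c 1) ^ 2) * hs
  · simp only [pairDet, contr_one_apply, h, Pi.smul_apply, smul_eq_mul]
    simp only [det2] at ht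
    linear_combination (-(q 0 * c 0 + q 1 * c 1) ^ 2) * ht
  · simp only [pairDet, contr_two_apply, h, Pi.smul_apply, smul_eq_mul]
    simp only [det2] at hz
    linear_combination (-(r 0 * c 0 + r 1 * c 1) ^ 2) * hz

theorem exists_dot_ne_zero {p : Fin 2 → ℂ} (hp : p ≠ 0) :
    ∃ c : Fin 2 → ℂ, (p 0 * c 0 + p 1 * c 1) ^ 2 ≠ 0 := by
  rcases fin_two_ne_zero hp with h | h
  · exact ⟨![1, 0], by simpa using h⟩
  · exact ⟨![0, 1], by simpa using h⟩

theorem pairDet_contr_of_hasFactor {φ : QState 3} :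
    (HasFactor 0 φ → ∀ c, pairDet (contr 1 c φ) = 0) ∧
    (HasFactor 1 φ → ∀ c, pairDet (contr 0 c φ) = 0) ∧
    (HasFactor 2 φ → ∀ c, pairDet (contr 0 c φ) = 0) := by
  refine ⟨fun h c => ?_, fun h c => ?_, fun h c => ?_⟩
  · obtain ⟨v, g, h⟩ := (hasFactor_zero_iff φ).1 h
    simp only [pairDet, contr_one_apply, h]; ring
  · obtain ⟨v, g, h⟩ := (hasFactor_one_iff φ).1 h
    simp only [pairDet, contr_zero_apply, h]; ring
  · obtain ⟨v, g, h⟩ := (hasFactor_two_iff φ).1 h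
    simp only [pairDet, contr_zero_apply, h]; ring

theorem IsWClass.not_hasFactor {φ : QState 3} (h : IsWClass φ) (i : Fin 3) : ¬ HasFactor i φ := by
  intro hf
  rw [isWClass_iff_isTangent] at h
  obtain ⟨p, q, r, hp, hq, hr, h0, h1, h2⟩ := h.pairDet_contr
  obtain ⟨c, hc⟩ := exists_dot_ne_zero hp
  obtain ⟨c', hc'⟩ := exists_dot_ne_zero hq
  rw [← h0] at hc
  rw [← h1] at hc'
  fin_cases i
  · exact hc' (pairDet_contr_of_hasFactor.1 hf c')
  · exact hc (pairDet_contr_of_hasFactor.2.1 hf c)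
  · exact hc (pairDet_contr_of_hasFactor.2.2 hf c)

/-- The hyperdeterminant vanishes on tangent vectors, and on a sum of two products it is the squared
product of three 2×2 determinants. If one of these is zero, the products share a factor. -/
theorem IsWClass.not_isTwoProducts {φ : QState 3} (h : IsWClass φ) : ¬ IsTwoProducts φ := by
  rintro ⟨p, q, r, p', q', r', hφ⟩
  have hd : hyperdet φ = 0 := by
    rw [isWClass_iff_isTangent] at h
    obtain ⟨p, u, q, v, r, w, -, -, -, h⟩ := h
    simp only [hyperdet, h]; ring
  have : (det2 p p' * det2 q q' * det2 r r') ^ 2 = 0 := by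
    rw [← hd]; simp only [hyperdet, hφ, det2]; ring
  have := pow_eq_zero_iff (two_ne_zero) |>.1 this
  rcases mul_eq_zero.1 this with h' | h'
  · rcases mul_eq_zero.1 h' with h' | h'
    · obtain ⟨e, s, t, hs, ht⟩ := exists_common_of_det2 h'
      refine h.not_hasFactor 0 ((hasFactor_zero_iff φ).2
        ⟨e, fun j k => s * q j * r k + t * q' j * r' k, fun i j k => ?_⟩)
      rw [hφ, hs, ht]; ring
    · obtain ⟨e, s, t, hs, ht⟩ := exists_common_of_det2 h'
      refine h.not_hasFactor 1 ((hasFactor_one_iff φ).2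
        ⟨e, fun i k => s * p i * r k + t * p' i * r' k, fun i j k => ?_⟩)
      rw [hφ, hs, ht]; ring
  · obtain ⟨e, s, t, hs, ht⟩ := exists_common_of_det2 h'
    refine h.not_hasFactor 2 ((hasFactor_two_iff φ).2
      ⟨e, fun i j => s * p i * q j + t * p' i * q' j, fun i j k => ?_⟩)
    rw [hφ, hs, ht]; ring

/-! ### Pencils of squares -/

/-- The binary quadratic form with coefficients `p`. -/
def binaryForm (p : Fin 3 → ℂ) (α : Fin 2 → ℂ) : ℂ :=
  p 0 * α 0 ^ 2 + p 1 * α 0 * α 1 + p 2 * α 1 ^ 2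

/-- At each nonzero `α`, the binary form with coefficients `p α, q α, r α` is a nonzero square. -/
def IsPencilOfSquares (p q r : Fin 3 → ℂ) : Prop :=
  ∀ α : Fin 2 → ℂ, α ≠ 0 → ∃ n : Fin 2 → ℂ, n ≠ 0 ∧ binaryForm p α = n 0 ^ 2 ∧
    binaryForm q α = 2 * n 0 * n 1 ∧ binaryForm r α = n 1 ^ 2

/-- Compare coefficients in `q² = 4pr` along `(1, t)`: the zero of `p` at `(1, 0)` must be double,
so `p` is a square, and then `q` and `r` are determined. -/
theorem IsPencilOfSquares.exists_linear_of_zero {p q r : Fin 3 → ℂ} (h : IsPencilOfSquares p q r)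
    (hp : p 0 = 0) : ∃ u v : Fin 2 → ℂ, det2 u v ≠ 0 ∧ ∀ α : Fin 2 → ℂ,
      binaryForm p α = (u 0 * α 0 + u 1 * α 1) ^ 2 ∧
      binaryForm q α = 2 * (u 0 * α 0 + u 1 * α 1) * (v 0 * α 0 + v 1 * α 1) ∧
      binaryForm r α = (v 0 * α 0 + v 1 * α 1) ^ 2 := by
  have hne : ∀ t : ℂ, (![1, t] : Fin 2 → ℂ) ≠ 0 := fun t h => by simpa using congrFun h 0
  have hf : ∀ t : ℂ, binaryForm q ![1, t] ^ 2 = 4 * binaryForm p ![1, t] * binaryForm r ![1, t] := by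
    intro t
    obtain ⟨n, -, e1, e2, e3⟩ := h _ (hne t)
    rw [e1, e2, e3]; ring
  obtain ⟨n, hn, e1, e2, e3⟩ := h _ (hne 0)
  simp [binaryForm, hp] at e1 e2 e3
  have hn0 : n 0 = 0 := by simpa using e1.symm
  have hq0 : q 0 = 0 := by rw [e2, hn0]; simp
  have hr0 : r 0 ≠ 0 := by
    rw [e3]
    refine pow_ne_zero 2 fun h1 => hn ?_
    ext i; fin_cases i
    · exact hn0
    · exact h1
  simp [binaryForm, hp, hq0] at hf
  have hp1 : p 1 = 0 := by
    have : r 0 * p 1 = 0 := by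
      -- This combination of values at `±1`, `±2` isolates the coefficient of `t`, which is `-4 * r
      -- 0 * p 1`.
      linear_combination (-1 / 48) * (8 * (hf 1 - hf (-1)) - (hf 2 - hf (-2)))
    exact (mul_eq_zero.1 this).resolve_left hr0
  simp [hp1] at hf
  -- Otherwise `p` vanishes identically, and at a root of `r` both entries of `n` would be zero.
  have hp2 : p 2 ≠ 0 := by
    intro hp2
    obtain ⟨k, hk, hk0⟩ := exists_binary_root (r 0) (r 1) (r 2)
    obtain ⟨n, hn, e1, e2, e3⟩ := h _ hk
    rw [binaryForm] at e1 e3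
    rw [hk0] at e3
    rw [hp, hp1, hp2] at e1
    apply hn
    ext i; fin_cases i
    · simpa using e1.symm
    · simpa using e3.symm
  obtain ⟨m, hm⟩ := exists_sq_eq (p 2)
  have hm0 : m ≠ 0 := by rintro rfl; apply hp2; rw [← hm]; simp
  have g : ∀ t : ℂ, t ≠ 0 → (q 1 + q 2 * t) ^ 2 = 4 * p 2 * (r 0 + r 1 * t + r 2 * t ^ 2) := by
    intro t ht
    have := hf t
    have h2 : t ^ 2 ≠ 0 := pow_ne_zero 2 ht
    apply mul_left_cancel₀ h2
    linear_combination this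
  have g1 := g 1 (by norm_num)
  have g2 := g (-1) (by norm_num)
  have g3 := g 2 (by norm_num)
  have c0 : q 1 ^ 2 = 4 * p 2 * r 0 := by linear_combination g1 + g2 / 3 - g3 / 3
  have c1 : q 1 * q 2 = 2 * p 2 * r 1 := by linear_combination (g1 - g2) / 4
  have c2 : q 2 ^ 2 = 4 * p 2 * r 2 := by linear_combination g1 / 2 + g2 / 2 - c0
  refine ⟨![0, m], ![q 1 / (2 * m), q 2 / (2 * m)], ?_, fun α => ⟨?_, ?_, ?_⟩⟩
  · have hq1 : q 1 ≠ 0 := by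
      intro h; rw [h] at c0
      have : p 2 * r 0 = 0 := by linear_combination -c0 / 4
      exact (mul_ne_zero hp2 hr0) this
    simp [det2, hm0, hq1]
  · simp [binaryForm, hp, hp1]; linear_combination (-α 1 ^ 2) * hm
  · simp [binaryForm, hq0]; field_simp
  · simp [binaryForm]; field_simp
    linear_combination (4 * (r 0 * α 0 ^ 2 + r 1 * α 0 * α 1 + r 2 * α 1 ^ 2)) * hm
      - α 0 ^ 2 * c0 - 2 * α 0 * α 1 * c1 - α 1 ^ 2 * c2

theorem IsPencilOfSquares.exists_linear {p q r : Fin 3 → ℂ} (h : IsPencilOfSquares p q r) :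
    ∃ u v : Fin 2 → ℂ, det2 u v ≠ 0 ∧ ∀ α : Fin 2 → ℂ,
      binaryForm p α = (u 0 * α 0 + u 1 * α 1) ^ 2 ∧
      binaryForm q α = 2 * (u 0 * α 0 + u 1 * α 1) * (v 0 * α 0 + v 1 * α 1) ∧
      binaryForm r α = (v 0 * α 0 + v 1 * α 1) ^ 2 := by
  obtain ⟨k, hk, hk0⟩ := exists_binary_root (p 0) (p 1) (p 2)
  obtain ⟨l, hkl⟩ := exists_det2_eq_one hk
  simp only [det2] at hkl
  -- Pullback of a form along `s ↦ s 0 • k + s 1 • l`, which moves the root `k` of `p` to `(1, 0)`.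
  let tr : (Fin 3 → ℂ) → Fin 3 → ℂ := fun p => ![binaryForm p k,
    2 * p 0 * k 0 * l 0 + p 1 * (k 0 * l 1 + k 1 * l 0) + 2 * p 2 * k 1 * l 1, binaryForm p l]
  have htr : ∀ p s, binaryForm (tr p) s =
      binaryForm p ![s 0 * k 0 + s 1 * l 0, s 0 * k 1 + s 1 * l 1] := by
    intro p s; simp [tr, binaryForm]; ring
  have h' : IsPencilOfSquares (tr p) (tr q) (tr r) := by
    intro s hs
    rw [htr, htr, htr]
    apply h
    intro h0
    have h1 := congrFun h0 0
    have h2 := congrFun h0 1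
    simp at h1 h2
    apply hs
    ext i; fin_cases i
    · simp; linear_combination l 1 * h1 - l 0 * h2 - s 0 * hkl
    · simp; linear_combination k 0 * h2 - k 1 * h1 - s 1 * hkl
  obtain ⟨u, v, huv, hs⟩ := h'.exists_linear_of_zero (by simpa [tr, binaryForm] using hk0)
  refine ⟨![u 0 * l 1 - u 1 * k 1, u 1 * k 0 - u 0 * l 0],
    ![v 0 * l 1 - v 1 * k 1, v 1 * k 0 - v 0 * l 0], ?_, fun α => ?_⟩
  · intro h0; apply huv
    simp [det2] at h0 ⊢
    linear_combination h0 - (u 0 * v 1 - u 1 * v 0) * hkl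
  · have hα : ![(l 1 * α 0 - l 0 * α 1) * k 0 + (k 0 * α 1 - k 1 * α 0) * l 0,
        (l 1 * α 0 - l 0 * α 1) * k 1 + (k 0 * α 1 - k 1 * α 0) * l 1] = α := by
      ext i; fin_cases i
      · simp; linear_combination α 0 * hkl
      · simp; linear_combination α 1 * hkl
    obtain ⟨e1, e2, e3⟩ := hs ![l 1 * α 0 - l 0 * α 1, k 0 * α 1 - k 1 * α 0]
    simp only [htr, Matrix.cons_val_zero, Matrix.cons_val_one, hα] at e1 e2 e3
    rw [e1, e2, e3]
    refine ⟨?_, ?_, ?_⟩ <;> simp <;> ring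

/-! ### Normal form of irreducible vectors -/

/-- A bilinear family of two-qubit vectors. -/
def bilinFamily (M : Fin 2 → Fin 2 → QState 2) (α c : Fin 2 → ℂ) : QState 2 :=
  fun y => ∑ x, c x * ∑ a, α a * M a x y

/-- The squared form at `α` is `u(α) * c 0 + v(α) * c 1` with `u`, `v` linear in `α`, so `c =
(-v(α), u(α))` kills it; the determinant of this map is `det2 u v`. -/
theorem exists_isotropic_map (M : Fin 2 → Fin 2 → QState 2)
    (h : ∀ α : Fin 2 → ℂ, α ≠ 0 → ∃ n : Fin 2 → ℂ, n ≠ 0 ∧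
      ∀ c, pairDet (bilinFamily M α c) = (n 0 * c 0 + n 1 * c 1) ^ 2) :
    ∃ S : Matrix (Fin 2) (Fin 2) ℂ, S.det ≠ 0 ∧
      ∀ α, pairDet (bilinFamily M α (S.mulVec α)) = 0 := by
  let mix : QState 2 → QState 2 → ℂ := fun N N' => N ![0, 0] * N' ![1, 1] + N ![1, 1] * N' ![0, 0]
    - N ![0, 1] * N' ![1, 0] - N ![1, 0] * N' ![0, 1]
  let p : Fin 3 → ℂ := ![pairDet (M 0 0), mix (M 0 0) (M 1 0), pairDet (M 1 0)]
  let q : Fin 3 → ℂ := ![mix (M 0 0) (M 0 1), mix (M 0 0) (M 1 1) + mix (M 1 0) (M 0 1),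
    mix (M 1 0) (M 1 1)]
  let r : Fin 3 → ℂ := ![pairDet (M 0 1), mix (M 0 1) (M 1 1), pairDet (M 1 1)]
  have key : ∀ α c, pairDet (bilinFamily M α c) =
      binaryForm p α * c 0 ^ 2 + binaryForm q α * c 0 * c 1 + binaryForm r α * c 1 ^ 2 := by
    intro α c
    simp [pairDet, bilinFamily, Fin.sum_univ_two, binaryForm, p, q, r, mix]
    ring
  have hP : IsPencilOfSquares p q r := by
    intro α hα
    obtain ⟨n, hn, hc⟩ := h α hα
    have h1 := hc ![1, 0]
    have h2 := hc ![0, 1]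
    have h3 := hc ![1, 1]
    rw [key] at h1 h2 h3
    simp at h1 h2 h3
    refine ⟨n, hn, h1, ?_, h2⟩
    linear_combination h3 - h1 - h2
  obtain ⟨u, v, huv, hα⟩ := hP.exists_linear
  refine ⟨!![-v 0, -v 1; u 0, u 1], ?_, fun α => ?_⟩
  · rw [Matrix.det_fin_two]
    intro h0; apply huv
    simp [det2] at h0 ⊢
    linear_combination h0
  · rw [key, (hα α).1, (hα α).2.1, (hα α).2.2]
    simp [Matrix.mulVec, dotProduct, Fin.sum_univ_two]
    ring

/-- The hypotheses make `b`, `c`, `d` annihilate the base points `p`, `q`, `r`. Each term leaves the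
base point on only one qubit, so two of these contractions always meet a base point. -/
theorem IsTangent.contr_contr {φ : QState 3} (h : IsTangent φ) (b c d : Fin 2 → ℂ)
    (hb : pairDet (contr 0 b φ) = 0) (hc : pairDet (contr 1 c φ) = 0)
    (hd : pairDet (contr 2 d φ) = 0) :
    (∀ k, ∑ i, ∑ j, b i * c j * φ ![i, j, k] = 0) ∧
    (∀ j, ∑ i, ∑ k, b i * d k * φ ![i, j, k] = 0) ∧
    (∀ i, ∑ j, ∑ k, c j * d k * φ ![i, j, k] = 0) := by
  obtain ⟨p, u, q, v, r, w, hp, hq, hr, h⟩ := h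
  have aux : ∀ x y z : ℂ, x ≠ 0 → y ≠ 0 → x * y * z ^ 2 = 0 → z = 0 := by
    intro x y z hx hy h
    simpa [hx, hy] using h
  have h0 : p 0 * b 0 + p 1 * b 1 = 0 := by
    refine aux _ _ _ hq hr ?_
    simp only [pairDet, contr_zero_apply, h] at hb
    simp only [det2]
    linear_combination -hb
  have h1 : q 0 * c 0 + q 1 * c 1 = 0 := by
    refine aux _ _ _ hp hr ?_
    simp only [pairDet, contr_one_apply, h] at hc
    simp only [det2]
    linear_combination -hc
  have h2 : r 0 * d 0 + r 1 * d 1 = 0 := by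
    refine aux _ _ _ hp hq ?_
    simp only [pairDet, contr_two_apply, h] at hd
    simp only [det2]
    linear_combination -hd
  refine ⟨fun k => ?_, fun j => ?_, fun i => ?_⟩ <;> simp only [Fin.sum_univ_two, h]
  · linear_combination ((u 0 * b 0 + u 1 * b 1) * r k) * h1 +
      ((v 0 * c 0 + v 1 * c 1) * r k + (q 0 * c 0 + q 1 * c 1) * w k) * h0
  · linear_combination ((u 0 * b 0 + u 1 * b 1) * q j) * h2 +
      ((r 0 * d 0 + r 1 * d 1) * v j + (w 0 * d 0 + w 1 * d 1) * q j) * h0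
  · linear_combination (u i * (q 0 * c 0 + q 1 * c 1) + p i * (v 0 * c 0 + v 1 * c 1)) * h2 +
      (p i * (w 0 * d 0 + w 1 * d 1)) * h1

/-- The coefficients of the vanishing cubic forms give linear equations whose solutions are spanned
by the singlet pairings 01|23 and 02|13. The two coefficients are read off at `0101` and `0011`. -/
theorem exists_singlet_pairs (G : Fin 2 → Fin 2 → Fin 2 → Fin 2 → ℂ)
    (h₁ : ∀ α : Fin 2 → ℂ, α ≠ 0 → ∀ l, ∑ i, ∑ j, ∑ k, α i * α j * α k * G i j k l = 0)
    (h₂ : ∀ α : Fin 2 → ℂ, α ≠ 0 → ∀ k, ∑ i, ∑ j, ∑ l, α i * α j * α l * G i j k l = 0)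
    (h₃ : ∀ α : Fin 2 → ℂ, α ≠ 0 → ∀ j, ∑ i, ∑ k, ∑ l, α i * α k * α l * G i j k l = 0) :
    ∃ f g f' g' : Fin 2 → Fin 2 → ℂ, ∀ i j k l, G i j k l = f i j * g k l + f' i k * g' j l := by
  have n0 : (![1, 0] : Fin 2 → ℂ) ≠ 0 := fun h => by simpa using congrFun h 0
  have n1 : (![0, 1] : Fin 2 → ℂ) ≠ 0 := fun h => by simpa using congrFun h 1
  have n2 : (![1, 1] : Fin 2 → ℂ) ≠ 0 := fun h => by simpa using congrFun h 0
  have n3 : (![1, -1] : Fin 2 → ℂ) ≠ 0 := fun h => by simpa using congrFun h 0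
  have sym : ∀ T : Fin 2 → Fin 2 → Fin 2 → ℂ,
      (∀ α : Fin 2 → ℂ, α ≠ 0 → ∑ i, ∑ j, ∑ k, α i * α j * α k * T i j k = 0) →
      T 0 0 0 = 0 ∧ T 1 1 1 = 0 ∧ T 0 0 1 + T 0 1 0 + T 1 0 0 = 0 ∧
        T 0 1 1 + T 1 0 1 + T 1 1 0 = 0 := by
    intro T hT
    have e0 := hT _ n0
    have e1 := hT _ n1
    have e2 := hT _ n2
    have e3 := hT _ n3
    simp [Fin.sum_univ_two] at e0 e1 e2 e3
    refine ⟨e0, e1, ?_, ?_⟩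
    · linear_combination (e2 - e3) / 2 - e1
    · linear_combination (e2 + e3) / 2 - e0
  have a := fun l => sym (fun i j k => G i j k l) (fun α hα => h₁ α hα l)
  have b := fun k => sym (fun i j l => G i j k l) (fun α hα => h₂ α hα k)
  have c := fun j => sym (fun i k l => G i j k l) (fun α hα => h₃ α hα j)
  obtain ⟨a1, a2, a3, a4⟩ := a 0
  obtain ⟨a5, a6, a7, a8⟩ := a 1
  obtain ⟨b1, b2, b3, b4⟩ := b 0
  obtain ⟨b5, b6, b7, b8⟩ := b 1
  obtain ⟨c1, c2, c3, c4⟩ := c 0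
  obtain ⟨c5, c6, c7, c8⟩ := c 1
  refine ⟨![![0, 1], ![-1, 0]], ![![0, G 0 1 0 1], ![-G 0 1 0 1, 0]],
    ![![0, 1], ![-1, 0]], ![![0, G 0 0 1 1], ![-G 0 0 1 1, 0]], fun i j k l => ?_⟩
  fin_cases i <;> fin_cases j <;> fin_cases k <;> fin_cases l <;> simp <;> grind

theorem eq_sum_of_mul_eq_one {S S' : Matrix (Fin 2) (Fin 2) ℂ} (h : S * S' = 1)
    (f : Fin 2 → ℂ) (j : Fin 2) : f j = ∑ m, (∑ n, f n * S n m) * S' m j := by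
  change f j = Matrix.vecMul (Matrix.vecMul f S) S' j
  rw [Matrix.vecMul_vecMul, h, Matrix.vecMul_one]

theorem contr_zero_apply_four (α : Fin 2 → ℂ) (ψ : QState 4) (j k l : Fin 2) :
    contr 0 α ψ ![j, k, l] = ∑ i, α i * ψ ![i, j, k, l] := by
  simp only [contr, (insertNth_three _ j k l).1]

/-- A vector with irreducible form is a sum of two vectors, each one a product of two
two-qubit vectors. -/
theorem HasIrreducibleForm.exists_pairs {ψ : QState 4} (h : HasIrreducibleForm ψ) :
    ∃ f g f' g' : Fin 2 → Fin 2 → ℂ, ∀ i j k l,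
      ψ ![i, j, k, l] = f i j * g k l + f' i k * g' j l := by
  rw [hasIrreducibleForm_iff] at h
  have hT : ∀ α : Fin 2 → ℂ, α ≠ 0 → IsTangent (contr 0 α ψ) := fun α hα =>
    (isWClass_iff_isTangent _).1 (h 0 α hα)
  have hM : ∀ i : Fin 3, ∃ M, ∀ α c, contr i c (contr 0 α ψ) = bilinFamily M α c := fun i =>
    ⟨fun a x y => ψ (Fin.insertNth (α := fun _ => Fin 2) 0 a
      (Fin.insertNth (α := fun _ => Fin 2) i x y)), fun α c => rfl⟩
  obtain ⟨M₀, hM₀⟩ := hM 0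
  obtain ⟨M₁, hM₁⟩ := hM 1
  obtain ⟨M₂, hM₂⟩ := hM 2
  obtain ⟨S, hS, hS'⟩ := exists_isotropic_map M₀ (fun α hα => by
    obtain ⟨p, q, r, hp, hq, hr, h0, h1, h2⟩ := (hT α hα).pairDet_contr
    exact ⟨p, hp, fun c => by rw [← hM₀, h0]⟩)
  obtain ⟨T, hT₁, hT'⟩ := exists_isotropic_map M₁ (fun α hα => by
    obtain ⟨p, q, r, hp, hq, hr, h0, h1, h2⟩ := (hT α hα).pairDet_contr
    exact ⟨q, hq, fun c => by rw [← hM₁, h1]⟩)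
  obtain ⟨U, hU, hU'⟩ := exists_isotropic_map M₂ (fun α hα => by
    obtain ⟨p, q, r, hp, hq, hr, h0, h1, h2⟩ := (hT α hα).pairDet_contr
    exact ⟨r, hr, fun c => by rw [← hM₂, h2]⟩)
  simp only [← hM₀] at hS'
  simp only [← hM₁] at hT'
  simp only [← hM₂] at hU'
  have hV := fun α hα => (hT α hα).contr_contr _ _ _ (hS' α) (hT' α) (hU' α)
  -- Here `S`, `T`, `U` act on qubits 1, 2, 3, so that the same `α` contracts every qubit; their
  -- inverses are applied afterwards and preserve the two products.
  obtain ⟨f, g, f', g', hG⟩ := exists_singlet_pairs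
    (fun i j k l => ∑ l', (∑ k', (∑ j', ψ ![i, j', k', l'] * S j' j) * T k' k) * U l' l)
    (fun α hα l => by
      have e := (hV α hα).1
      have e0 := e 0
      have e1 := e 1
      simp only [Matrix.mulVec, dotProduct, Fin.sum_univ_two, contr_zero_apply_four] at e0 e1 ⊢
      linear_combination U 0 l * e0 + U 1 l * e1)
    (fun α hα k => by
      have e := (hV α hα).2.1
      have e0 := e 0
      have e1 := e 1
      simp only [Matrix.mulVec, dotProduct, Fin.sum_univ_two, contr_zero_apply_four] at e0 e1 ⊢
      linear_combination T 0 k * e0 + T 1 k * e1)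
    (fun α hα j => by
      have e := (hV α hα).2.2
      have e0 := e 0
      have e1 := e 1
      simp only [Matrix.mulVec, dotProduct, Fin.sum_univ_two, contr_zero_apply_four] at e0 e1 ⊢
      linear_combination S 0 j * e0 + S 1 j * e1)
  have hinv : ∀ A : Matrix (Fin 2) (Fin 2) ℂ, A.det ≠ 0 → A * A⁻¹ = 1 := fun A hA =>
    Matrix.mul_nonsing_inv _ (isUnit_iff_ne_zero.2 hA)
  refine ⟨fun i j => ∑ m, f i m * S⁻¹ m j, fun k l => ∑ m, (∑ n, g n m * T⁻¹ n k) * U⁻¹ m l,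
    fun i k => ∑ n, f' i n * T⁻¹ n k, fun j l => ∑ m, (∑ n, g' n m * S⁻¹ n j) * U⁻¹ m l,
    fun i j k l => ?_⟩
  have e1 := eq_sum_of_mul_eq_one (hinv S hS) (fun j => ψ ![i, j, k, l]) j
  have e2 := fun m => eq_sum_of_mul_eq_one (hinv T hT₁)
    (fun k => ∑ n, ψ ![i, n, k, l] * S n m) k
  have e3 := fun m n => eq_sum_of_mul_eq_one (hinv U hU)
    (fun l => ∑ k', (∑ j', ψ ![i, j', k', l] * S j' m) * T k' n) l
  simp only [hG] at e3
  simp only [e3] at e2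
  simp only [e2] at e1
  rw [e1]
  simp only [Fin.sum_univ_two]
  ring

/-! ### The state Ψ⁽⁴⁾ -/

/-- A factor at qubit 1 or 2 makes all contractions of qubit 0 singular, and a factor at qubit 0
those of qubit 1. -/
theorem isWClass_of_pairDet {φ : QState 3} (h : hyperdet φ = 0)
    (h0 : ∃ c, pairDet (contr 0 c φ) ≠ 0) (h1 : ∃ c, pairDet (contr 1 c φ) ≠ 0) : IsWClass φ := by
  refine (isWClass_or_hasFactor_of_hyperdet h).resolve_right ?_
  rintro ⟨i, hi⟩
  obtain ⟨c, hc⟩ := h0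
  obtain ⟨d, hd⟩ := h1
  fin_cases i
  · exact hd (pairDet_contr_of_hasFactor.1 hi d)
  · exact hc (pairDet_contr_of_hasFactor.2.1 hi c)
  · exact hc (pairDet_contr_of_hasFactor.2.2 hi c)

theorem psiFour_apply (i j k l : Fin 2) : psiFour ![i, j, k, l] = (Real.sqrt (1 / 3) : ℂ) *
    (![![![![0, 0], ![0, -1]], ![![0, 1 / 2], ![1 / 2, 0]]],
      ![![![0, 1 / 2], ![1 / 2, 0]], ![![-1, 0], ![0, 0]]]] : Fin 2 → Fin 2 → Fin 2 → Fin 2 → ℂ)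
      i j k l := by
  have e : ∀ (x y z w : Fin 2), ket ![x, y, z, w] ![i, j, k, l] =
      if i = x ∧ j = y ∧ k = z ∧ l = w then 1 else 0 := by
    intro x y z w
    simp only [ket, Pi.single_apply]
    congr 1
    simp [Matrix.vecCons_inj]
  simp only [psiFour, Pi.smul_apply, Pi.add_apply, Pi.sub_apply, e, smul_eq_mul]
  fin_cases i <;> fin_cases j <;> fin_cases k <;> fin_cases l <;> simp

theorem psiFour_hasIrreducibleForm : HasIrreducibleForm psiFour := by
  rw [hasIrreducibleForm_iff]
  intro a c hc
  have hs : (Real.sqrt (1 / 3) : ℂ) ≠ 0 := by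
    rw [Ne, Complex.ofReal_eq_zero]; positivity
  refine isWClass_of_pairDet ?_ ?_ ?_
  · fin_cases a <;> simp [hyperdet, contr, insertNth_three, psiFour_apply] <;> ring
  -- Fixing a second qubit at 1 leaves a determinant that is a nonzero multiple of `c 0 ^ 2`; fixing
  -- it at 0 gives `c 1 ^ 2` instead.
  · rcases fin_two_ne_zero hc with h | h
    · refine ⟨![0, 1], ?_⟩
      fin_cases a <;> simp [pairDet, contr, insertNth_three, psiFour_apply, h]
    · refine ⟨![1, 0], ?_⟩
      fin_cases a <;> simp [pairDet, contr, insertNth_three, psiFour_apply, h]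
  · rcases fin_two_ne_zero hc with h | h
    · refine ⟨![0, 1], ?_⟩
      fin_cases a <;> simp [pairDet, contr, insertNth_two, insertNth_three, psiFour_apply, h]
    · refine ⟨![1, 0], ?_⟩
      fin_cases a <;> simp [pairDet, contr, insertNth_two, insertNth_three, psiFour_apply, h]

theorem psiFour_norm : ∑ x, ‖psiFour x‖ ^ 2 = 1 := by
  have e : ∀ f : (Fin 4 → Fin 2) → ℝ, ∑ x, f x = ∑ i, ∑ j, ∑ k, ∑ l, f ![i, j, k, l] := by
    intro f
    simp only [← Fintype.sum_prod_type']
    refine Fintype.sum_equiv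
      ⟨fun x => (x 0, x 1, x 2, x 3), fun p => ![p.1, p.2.1, p.2.2.1, p.2.2.2], fun x => vec4_eta x,
        fun p => rfl⟩ _ _ (fun x => ?_)
    exact congrArg f (vec4_eta x).symm
  rw [e]
  simp [psiFour_apply, Fin.sum_univ_two, mul_pow]
  norm_num

/-! ### Structure of trees -/

namespace QTree

variable {n m : ℕ}

/-- Relabelling of the qubits of a tree. -/
def map (g : Fin n → Fin m) : QTree n → QTree m
  | leaf i v => leaf (g i) v
  | plus s t => plus (s.map g) (t.map g)
  | tensor s t => tensor (s.map g) (t.map g)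

theorem size_map (g : Fin n → Fin m) (t : QTree n) : (t.map g).size = t.size := by
  induction t <;> simp_all [map, size]

theorem qubits_map (g : Fin n → Fin m) (t : QTree n) : (t.map g).qubits = t.qubits.image g := by
  induction t <;> simp_all [map, qubits, Finset.image_union]

theorem amplitude_map (g : Fin n → Fin m) (t : QTree n) (x : Fin m → Fin 2) :
    (t.map g).amplitude x = t.amplitude (fun i => x (g i)) := by
  induction t <;> simp_all [map, amplitude]

theorem WellFormed.map {g : Fin n → Fin m} {t : QTree n} (h : t.WellFormed)
    (hg : Set.InjOn g t.qubits) : (t.map g).WellFormed := by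
  induction t with
  | leaf i v => trivial
  | plus s t hs ht =>
    obtain ⟨h1, h2, h3⟩ := h
    simp only [qubits, Finset.coe_union] at hg
    exact ⟨hs h1 (hg.mono Set.subset_union_left), ht h2 (hg.mono Set.subset_union_right), by
      rw [qubits_map, qubits_map, h3]⟩
  | tensor s t hs ht =>
    obtain ⟨h1, h2, h3⟩ := h
    simp only [qubits, Finset.coe_union] at hg
    refine ⟨hs h1 (hg.mono Set.subset_union_left), ht h2 (hg.mono Set.subset_union_right), ?_⟩
    rw [qubits_map, qubits_map, Finset.disjoint_left]
    intro x hx hx'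
    obtain ⟨i, hi, rfl⟩ := Finset.mem_image.1 hx
    obtain ⟨j, hj, hij⟩ := Finset.mem_image.1 hx'
    have := hg (Or.inr hj) (Or.inl hi) hij
    subst this
    exact Finset.disjoint_left.1 h3 hi hj

theorem qubits_nonempty (t : QTree n) : t.qubits.Nonempty := by
  induction t with
  | leaf i v => exact ⟨i, by simp [qubits]⟩
  | plus s t hs ht => exact hs.mono Finset.subset_union_left
  | tensor s t hs ht => exact hs.mono Finset.subset_union_left

theorem card_qubits_le_size (t : QTree n) : t.qubits.card ≤ t.size := by
  induction t with
  | leaf i v => simp [qubits, size]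
  | plus s t hs ht => exact (Finset.card_union_le _ _).trans (add_le_add hs ht)
  | tensor s t hs ht => exact (Finset.card_union_le _ _).trans (add_le_add hs ht)

theorem amplitude_congr (t : QTree n) {x y : Fin n → Fin 2} (h : ∀ i ∈ t.qubits, x i = y i) :
    t.amplitude x = t.amplitude y := by
  induction t with
  | leaf i v => simp [amplitude, h i (by simp [qubits])]
  | plus s t hs ht =>
    simp only [amplitude]
    rw [hs fun i hi => h i (Finset.mem_union_left _ hi),
      ht fun i hi => h i (Finset.mem_union_right _ hi)]
  | tensor s t hs ht =>
    simp only [amplitude]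
    rw [hs fun i hi => h i (Finset.mem_union_left _ hi),
      ht fun i hi => h i (Finset.mem_union_right _ hi)]

theorem amplitude_update (t : QTree n) {i : Fin n} (hi : i ∉ t.qubits) (x : Fin n → Fin 2)
    (b : Fin 2) : t.amplitude (Function.update x i b) = t.amplitude x := by
  refine amplitude_congr t fun j hj => ?_
  rw [Function.update_of_ne]
  rintro rfl
  exact hi hj

theorem exists_amplitude_of_singleton {t : QTree n} {i : Fin n} (h : t.qubits = {i}) :
    ∃ v : Fin 2 → ℂ, ∀ x, t.amplitude x = v (x i) :=
  ⟨fun b => t.amplitude fun _ => b, fun x => amplitude_congr t fun j hj => by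
    rw [h, Finset.mem_singleton] at hj; rw [hj]⟩

/-- A tree with at most one leaf more than it has qubits describes a product vector. -/
theorem WellFormed.exists_prod {t : QTree n} (h : t.WellFormed)
    (hs : t.size ≤ t.qubits.card + 1) :
    ∃ v : Fin n → Fin 2 → ℂ, ∀ x, t.amplitude x = ∏ i ∈ t.qubits, v i (x i) := by
  induction t with
  | leaf i v => exact ⟨fun _ => v, fun x => by simp [amplitude, qubits]⟩
  | plus s t _ _ =>
    obtain ⟨h1, h2, h3⟩ := h
    have hq : (plus s t).qubits = t.qubits := by simp [qubits, h3]
    have c1 := s.card_qubits_le_size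
    have c2 := t.card_qubits_le_size
    have c3 := t.qubits_nonempty.card_pos
    rw [hq] at hs
    rw [h3] at c1
    simp only [size] at hs
    -- Both inputs of a `+` gate use all the qubits, so twice their number is at most one more than
    -- their number.
    obtain ⟨i, hi⟩ := Finset.card_eq_one.1 (show t.qubits.card = 1 by omega)
    rw [← hq] at hi
    obtain ⟨v, hv⟩ := exists_amplitude_of_singleton hi
    exact ⟨fun _ => v, fun x => by rw [hv, hi, Finset.prod_singleton]⟩
  | tensor s t ihs iht =>
    obtain ⟨h1, h2, h3⟩ := h
    have c1 := s.card_qubits_le_size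
    have c2 := t.card_qubits_le_size
    simp only [size, qubits, Finset.card_union_of_disjoint h3] at hs
    obtain ⟨v, hv⟩ := ihs h1 (by omega)
    obtain ⟨w, hw⟩ := iht h2 (by omega)
    refine ⟨fun i => if i ∈ s.qubits then v i else w i, fun x => ?_⟩
    simp only [amplitude, qubits, hv, hw]
    rw [Finset.prod_union h3]
    congr 1
    · exact Finset.prod_congr rfl fun i hi => by simp [hi]
    · exact Finset.prod_congr rfl fun i hi => by simp [Finset.disjoint_right.1 h3 hi]

/-- `t` is a `⊗` gate. -/
def IsTensor (t : QTree n) : Prop := ∃ s u, t = tensor s u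

/-- A tree is a `⊗` gate, or the sum of a `⊗` gate and another tree. -/
theorem WellFormed.isTensor_or {t : QTree n} (h : t.WellFormed) (hc : 2 ≤ t.qubits.card) :
    t.IsTensor ∨ ∃ s r : QTree n, s.IsTensor ∧ s.WellFormed ∧ r.WellFormed ∧
      s.qubits = t.qubits ∧ r.qubits = t.qubits ∧ t.size = s.size + r.size ∧
      ∀ x, t.amplitude x = s.amplitude x + r.amplitude x := by
  induction t with
  | leaf i v => simp [qubits] at hc
  | tensor s t _ _ => exact Or.inl ⟨s, t, rfl⟩
  | plus s t ihs _ =>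
    obtain ⟨h1, h2, h3⟩ := h
    have hq : (plus s t).qubits = s.qubits := by simp [qubits, h3]
    right
    rw [hq] at hc ⊢
    rcases ihs h1 hc with hs | ⟨a, r, ha, hwa, hwr, hqa, hqr, hsz, hamp⟩
    · exact ⟨s, t, hs, h1, h2, rfl, h3.symm, rfl, fun x => rfl⟩
    · refine ⟨a, plus r t, ha, hwa, ⟨hwr, h2, by rw [hqr, h3]⟩, hqa, by simp [qubits, hqr, h3], ?_,
        fun x => ?_⟩
      · simp only [size, hsz]; ring
      · simp only [amplitude, hamp]; ring

end QTree

/-! ### Lower bounds for trees -/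

open QTree in
theorem hasFactor_of_amplitude {n : ℕ} {s u : QTree n} {i : Fin n} (hs : s.qubits = {i})
    (hu : i ∉ u.qubits) : HasFactor i (fun x => s.amplitude x * u.amplitude x) := by
  obtain ⟨v, hv⟩ := exists_amplitude_of_singleton hs
  exact ⟨v, u.amplitude, fun x b => amplitude_update u hu x b, fun x => by simp only [hv]⟩

theorem QTree.WellFormed.exists_hasFactor {t : QTree 3} (h : t.WellFormed)
    (hq : t.qubits = Finset.univ) (ht : t.IsTensor) : ∃ i, HasFactor i t.amplitude := by
  obtain ⟨s, u, rfl⟩ := ht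
  obtain ⟨h1, h2, h3⟩ := h
  have hc : s.qubits.card + u.qubits.card = 3 := by
    rw [← Finset.card_union_of_disjoint h3]
    change (tensor s u).qubits.card = 3
    rw [hq]; rfl
  have c1 := s.qubits_nonempty.card_pos
  have c2 := u.qubits_nonempty.card_pos
  rcases (show s.qubits.card = 1 ∨ u.qubits.card = 1 by omega) with hc | hc
  · obtain ⟨i, hi⟩ := Finset.card_eq_one.1 hc
    exact ⟨i, hasFactor_of_amplitude hi (Finset.disjoint_left.1 h3 (by simp [hi]))⟩
  · obtain ⟨i, hi⟩ := Finset.card_eq_one.1 hc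
    have := hasFactor_of_amplitude hi (Finset.disjoint_right.1 h3 (show i ∈ u.qubits by simp [hi]))
    refine ⟨i, ?_⟩
    convert this using 1
    ext x
    simp only [QTree.amplitude]; ring

/-- A three-qubit vector of the W class has tree size at least `8`. -/
theorem not_isWClass_of_size_le {t : QTree 3} {φ : QState 3} (h : t.Describes φ)
    (hs : t.size ≤ 7) : ¬ IsWClass φ := by
  obtain ⟨hw, hq, rfl⟩ := h
  have hcard : (Finset.univ : Finset (Fin 3)).card = 3 := rfl
  intro hW
  rcases hw.isTensor_or (by rw [hq]; simp) with ht | ⟨s, r, hs', hws, hwr, hqs, hqr, hsz, hamp⟩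
  · obtain ⟨i, hi⟩ := hw.exists_hasFactor hq ht
    exact hW.not_hasFactor i hi
  · rw [hq] at hqs hqr
    have c1 := s.card_qubits_le_size
    have c2 := r.card_qubits_le_size
    rw [hqs] at c1
    rw [hqr] at c2
    -- Each summand has at least 3 of at most 7 leaves, hence at most 4, and is a product.
    obtain ⟨v, hv⟩ := hws.exists_prod (by rw [hqs]; omega)
    obtain ⟨w, hw'⟩ := hwr.exists_prod (by rw [hqr]; omega)
    refine hW.not_isTwoProducts ⟨v 0, v 1, v 2, w 0, w 1, w 2, fun i j k => ?_⟩
    rw [hamp, hv, hw', hqs, hqr, Fin.prod_univ_three, Fin.prod_univ_three]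
    rfl

theorem contr_add {n : ℕ} (a : Fin (n + 1)) (c : Fin 2 → ℂ) (f g : QState (n + 1)) :
    contr a c (fun x => f x + g x) = fun y => contr a c f y + contr a c g y := by
  ext y
  simp only [contr, mul_add, Finset.sum_add_distrib]

/-- The contraction of a factor. -/
theorem contr_mul_eq {n : ℕ} (a : Fin (n + 1)) (c v : Fin 2 → ℂ) (g : QState (n + 1))
    (hg : ∀ x b, g (Function.update x a b) = g x) :
    contr a c (fun x => v (x a) * g x) =
      fun y => (c 0 * v 0 + c 1 * v 1) * g (Fin.insertNth (α := fun _ => Fin 2) a 0 y) := by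
  ext y
  have h : ∀ b, g (Fin.insertNth (α := fun _ => Fin 2) a b y) =
      g (Fin.insertNth (α := fun _ => Fin 2) a 0 y) := fun b => by
    rw [← Fin.update_insertNth (α := fun _ => Fin 2) a 0 b y, hg]
  simp only [contr, Fin.sum_univ_two, Fin.insertNth_apply_same, h]
  ring

theorem exists_contr_killing (v : Fin 2 → ℂ) :
    ∃ c : Fin 2 → ℂ, c ≠ 0 ∧ c 0 * v 0 + c 1 * v 1 = 0 := by
  obtain ⟨k, hk, h, -⟩ := exists_kernel (a := v 0) (b := v 1) (c := 0) (d := 0) (by simp)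
  exact ⟨k, hk, by linear_combination h⟩

/-- A functional that kills the factor of `f` on qubit `a` makes the contractions of `ψ` and `r`
equal. -/
theorem HasIrreducibleForm.exists_isWClass_contr {ψ : QState 4} (h : HasIrreducibleForm ψ)
    {a : Fin 4} {f r : QState 4} (hf : HasFactor a f) (hψ : ∀ x, ψ x = f x + r x) :
    ∃ c, IsWClass (contr a c r) := by
  obtain ⟨v, g, hg, hf⟩ := hf
  obtain ⟨c, hc, hcv⟩ := exists_contr_killing v
  refine ⟨c, ?_⟩
  have := (hasIrreducibleForm_iff ψ).1 h a c hc
  have e : ψ = fun x => v (x a) * g x + r x := by ext x; rw [hψ, hf]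
  rw [e, contr_add, contr_mul_eq _ _ _ _ hg, hcv] at this
  simpa using this

theorem HasFactor.contr {n : ℕ} {a : Fin (n + 1)} {j : Fin n} {f : QState (n + 1)}
    (h : HasFactor (a.succAbove j) f) (c : Fin 2 → ℂ) : HasFactor j (contr a c f) := by
  obtain ⟨v, g, hg, hf⟩ := h
  refine ⟨v, _root_.contr a c g, fun x b => ?_, fun x => ?_⟩
  · simp only [_root_.contr, Fin.insertNth_update (α := fun _ => Fin 2), hg]
  · simp only [_root_.contr, hf, Fin.insertNth_apply_succAbove, Finset.mul_sum]
    exact Finset.sum_congr rfl fun b _ => by ring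

theorem HasFactor.not_isWClass_contr {a j : Fin 4} {f : QState 4} (h : HasFactor j f)
    (hj : j ≠ a) (c : Fin 2 → ℂ) : ¬ IsWClass (_root_.contr a c f) := by
  obtain ⟨j', rfl⟩ := Fin.exists_succAbove_eq hj
  exact fun hW => hW.not_hasFactor j' (h.contr c)

theorem IsWClass.of_smul {s : ℂ} {φ : QState 3} (h : IsWClass fun x => s * φ x) : IsWClass φ := by
  have hs : s ≠ 0 := by
    rintro rfl
    refine h.not_hasFactor 0 ⟨0, fun _ => 0, fun _ _ => rfl, fun x => by simp⟩
  rw [isWClass_iff_isTangent] at h ⊢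
  obtain ⟨p, u, q, v, r, w, hp, hq, hr, h⟩ := h
  refine ⟨fun i => p i / s, fun i => u i / s, q, v, r, w, ?_, hq, hr, fun i j k => ?_⟩
  · have : det2 (fun i => p i / s) (fun i => u i / s) = det2 p u / s ^ 2 := by
      simp only [det2]; field_simp
    rw [this]
    exact div_ne_zero hp (pow_ne_zero 2 hs)
  · have := h i j k
    field_simp
    linear_combination this

/-- `f` is the product of a single-qubit vector and a vector with a tree with fewer than
`k` leaves. -/
def IsSingleSplit (k : ℕ) (f : QState 4) : Prop :=
  ∃ (a : Fin 4) (v : Fin 2 → ℂ) (t : QTree 4), t.WellFormed ∧ t.qubits = {a}ᶜ ∧ t.size < k ∧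
    ∀ x, f x = v (x a) * t.amplitude x

/-- `f` is a product of two two-qubit vectors. -/
def IsPairSplit (f : QState 4) : Prop :=
  ∃ s t : QTree 4, s.qubits.card = 2 ∧ t.qubits = s.qubitsᶜ ∧
    ∀ x, f x = s.amplitude x * t.amplitude x

theorem isSingleSplit_hasFactor {a : Fin 4} {v : Fin 2 → ℂ} {t : QTree 4} {f : QState 4}
    (ht : t.qubits = {a}ᶜ) (h : ∀ x, f x = v (x a) * t.amplitude x) : HasFactor a f :=
  ⟨v, t.amplitude, fun x b => QTree.amplitude_update t (by simp [ht]) x b, h⟩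

/-- Contracting one qubit of a pair leaves its partner as a factor. -/
theorem IsPairSplit.not_isWClass_contr {f : QState 4} (h : IsPairSplit f) (a : Fin 4)
    (c : Fin 2 → ℂ) : ¬ IsWClass (contr a c f) := by
  have main : ∀ s t : QTree 4, s.qubits.card = 2 → t.qubits = s.qubitsᶜ →
      (∀ x, f x = s.amplitude x * t.amplitude x) → a ∈ s.qubits → ¬ IsWClass (contr a c f) := by
    intro s t hs ht hf ha
    obtain ⟨j, hj⟩ := Finset.card_eq_one.1
      (show (s.qubits.erase a).card = 1 by rw [Finset.card_erase_of_mem ha, hs])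
    have hja : j ≠ a := Finset.ne_of_mem_erase (by rw [hj]; simp)
    have hjs : j ∈ s.qubits := Finset.mem_of_mem_erase (a := a) (by rw [hj]; simp)
    have hs' : ∀ i ∈ s.qubits, i = a ∨ i = j := by
      intro i hi
      by_cases h : i = a
      · exact Or.inl h
      · exact Or.inr (by simpa [hj] using Finset.mem_erase.2 ⟨h, hi⟩)
    obtain ⟨j', rfl⟩ := Fin.exists_succAbove_eq hja
    intro hW
    refine hW.not_hasFactor j' ⟨fun m => ∑ b, c b *
      s.amplitude (Fin.insertNth (α := fun _ => Fin 2) a b fun _ => m),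
      fun y => t.amplitude (Fin.insertNth (α := fun _ => Fin 2) a 0 y), fun x b => ?_, fun x => ?_⟩
    · simp only [Fin.insertNth_update (α := fun _ => Fin 2)]
      exact QTree.amplitude_update t (by simp [ht, hjs]) _ _
    · simp only [contr, hf, Finset.sum_mul]
      refine Finset.sum_congr rfl fun b _ => ?_
      rw [← Fin.update_insertNth (α := fun _ => Fin 2) a 0 b x,
        QTree.amplitude_update t (by simp [ht, ha]), Fin.update_insertNth (α := fun _ => Fin 2),
        ← mul_assoc]
      congr 2
      refine QTree.amplitude_congr s fun i hi => ?_
      rcases hs' i hi with rfl | rfl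
      · simp
      · simp
  obtain ⟨s, t, hs, ht, hf⟩ := h
  by_cases ha : a ∈ s.qubits
  · exact main s t hs ht hf ha
  · refine main t s ?_ (by rw [ht, compl_compl]) (fun x => by rw [hf, mul_comm]) (by simp [ht, ha])
    rw [ht, Finset.card_compl, hs]; rfl

theorem eq_compl_of_disjoint_union {ι : Type*} [Fintype ι] [DecidableEq ι] {S T : Finset ι}
    (h : Disjoint S T) (hu : S ∪ T = Finset.univ) : T = Sᶜ :=
  (IsCompl.compl_eq ⟨h, codisjoint_iff.2 hu⟩).symm

/-- The qubits split as 1+3 or 2+2. A two-qubit input with at most 3 leaves is itself a product, so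
one of its qubits can be split off; otherwise both inputs have at least 4 leaves. -/
theorem QTree.WellFormed.split {t : QTree 4} (h : t.WellFormed) (hq : t.qubits = Finset.univ)
    (ht : t.IsTensor) : IsSingleSplit t.size t.amplitude ∨
      (8 ≤ t.size ∧ IsPairSplit t.amplitude) := by
  obtain ⟨s, u, rfl⟩ := ht
  obtain ⟨h1, h2, h3⟩ := h
  simp only [qubits] at hq
  have key : ∀ s u : QTree 4, s.WellFormed → u.WellFormed → Disjoint s.qubits u.qubits →
      s.qubits ∪ u.qubits = Finset.univ →
      (s.qubits.card = 1 ∨ s.qubits.card = 2 ∧ s.size ≤ 3) →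
      IsSingleSplit (s.size + u.size) (fun x => s.amplitude x * u.amplitude x) := by
    intro s u h1 h2 h3 hq hs
    have hu := eq_compl_of_disjoint_union h3 hq
    rcases hs with hs | ⟨hs, hs3⟩
    · obtain ⟨i, hi⟩ := Finset.card_eq_one.1 hs
      obtain ⟨v, hv⟩ := exists_amplitude_of_singleton hi
      have := s.card_qubits_le_size
      exact ⟨i, v, u, h2, by rw [hu, hi], by omega, fun x => by simp only [hv]⟩
    · obtain ⟨v, hv⟩ := h1.exists_prod (by omega)
      have := s.card_qubits_le_size
      obtain ⟨i, j, hij, hsij⟩ := Finset.card_eq_two.1 hs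
      refine ⟨i, v i, tensor (leaf j (v j)) u, ⟨trivial, h2, ?_⟩, ?_, ?_, fun x => ?_⟩
      · simp [qubits, hu, hsij]
      · ext k
        simp only [qubits, hu, hsij, Finset.mem_union, Finset.mem_singleton, Finset.mem_compl,
          Finset.mem_insert]
        constructor
        · rintro (rfl | h)
          · exact hij.symm
          · tauto
        · tauto
      · simp only [size]; omega
      · simp only [hv, hsij, Finset.prod_pair hij]
        simp only [amplitude]; ring
  have hc : s.qubits.card + u.qubits.card = 4 := by
    rw [← Finset.card_union_of_disjoint h3, hq]; rfl
  have c1 := s.qubits_nonempty.card_pos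
  have c2 := u.qubits_nonempty.card_pos
  by_cases hs : s.qubits.card = 1 ∨ s.qubits.card = 2 ∧ s.size ≤ 3
  · exact Or.inl (key s u h1 h2 h3 hq hs)
  by_cases hu : u.qubits.card = 1 ∨ u.qubits.card = 2 ∧ u.size ≤ 3
  · left
    have := key u s h2 h1 h3.symm (by rw [Finset.union_comm, hq]) hu
    convert this using 1
    · simp only [size]; ring
    · ext x; simp only [amplitude]; ring
  right
  refine ⟨by simp only [size]; omega, s, u, by omega,
    eq_compl_of_disjoint_union h3 hq, fun x => rfl⟩

/-- The contraction is a multiple of the vector of `t`, which after relabelling is a three-qubit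
tree with at most 7 leaves. -/
theorem not_isWClass_contr_of_size_lt {a : Fin 4} {v : Fin 2 → ℂ} {t : QTree 4}
    (hw : t.WellFormed) (hq : t.qubits = {a}ᶜ) (hs : t.size < 8) (c : Fin 2 → ℂ) :
    ¬ IsWClass (contr a c fun x => v (x a) * t.amplitude x) := by
  rw [contr_mul_eq _ _ _ _ (fun x b => QTree.amplitude_update t (by simp [hq]) x b)]
  intro hW
  have hW := hW.of_smul
  have hg : Function.LeftInverse (Function.invFun a.succAbove) a.succAbove :=
    Function.leftInverse_invFun Fin.succAbove_right_injective
  have hinv : ∀ i ∈ t.qubits, a.succAbove (Function.invFun a.succAbove i) = i := by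
    intro i hi
    rw [hq] at hi
    obtain ⟨j, rfl⟩ := Fin.exists_succAbove_eq (show i ≠ a by simpa using hi)
    rw [hg]
  refine not_isWClass_of_size_le (t := t.map (Function.invFun a.succAbove)) ⟨hw.map ?_, ?_, ?_⟩
    (by rw [QTree.size_map]; omega) hW
  · intro i hi j hj hij
    rw [← hinv i hi, ← hinv j hj, hij]
  · ext j
    simp only [QTree.qubits_map, Finset.mem_image, Finset.mem_univ, iff_true]
    exact ⟨a.succAbove j, by simp [hq], hg j⟩
  · ext y
    rw [QTree.amplitude_map]
    refine QTree.amplitude_congr t fun i hi => ?_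
    conv_rhs => rw [← hinv i hi]
    simp

theorem isTwoProducts_contr (v w : Fin 4 → Fin 2 → ℂ) (a : Fin 4) (c : Fin 2 → ℂ) :
    IsTwoProducts (contr a c fun x => ∏ i, v i (x i) + ∏ i, w i (x i)) := by
  refine ⟨fun m => (∑ b, c b * v a b) * v (a.succAbove 0) m, v (a.succAbove 1),
    v (a.succAbove 2), fun m => (∑ b, c b * w a b) * w (a.succAbove 0) m, w (a.succAbove 1),
    w (a.succAbove 2), fun i j k => ?_⟩
  simp only [contr, Fin.prod_univ_succAbove _ a, Fin.insertNth_apply_same,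
    Fin.insertNth_apply_succAbove, Fin.prod_univ_three, Fin.sum_univ_two]
  simp
  ring

/-- The tree size of a vector with irreducible form is at least `16`. -/
theorem HasIrreducibleForm.le_size {ψ : QState 4} (h : HasIrreducibleForm ψ) {t : QTree 4}
    (ht : t.Describes ψ) : 16 ≤ t.size := by
  obtain ⟨hw, hq, hψ⟩ := ht
  have hcard : (Finset.univ : Finset (Fin 4)).card = 4 := rfl
  by_contra! hlt
  have hW := (hasIrreducibleForm_iff ψ).1 h
  have single : ∀ (k : ℕ) (f r : QState 4), IsSingleSplit k f → (∀ x, ψ x = f x + r x) →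
      ∃ a c, HasFactor a f ∧ IsWClass (contr a c r) := by
    rintro k f r ⟨a, v, t, -, hq, -, hf⟩ hψ
    have hF := isSingleSplit_hasFactor hq hf
    obtain ⟨c, hc⟩ := h.exists_isWClass_contr hF hψ
    exact ⟨a, c, hF, hc⟩
  have hne : (![1, 0] : Fin 2 → ℂ) ≠ 0 := fun h => by simpa using congrFun h 0
  -- Killing the qubit that `r` splits off leaves a sum of two products, which is not W.
  have triple : ∀ s u r : QTree 4, s.WellFormed → u.WellFormed → r.WellFormed →
      s.qubits = Finset.univ → u.qubits = Finset.univ → r.qubits = Finset.univ → r.IsTensor →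
      s.size ≤ 5 → u.size ≤ 5 → r.size ≤ 7 →
      (∀ x, ψ x = r.amplitude x + (s.amplitude x + u.amplitude x)) → False := by
    intro s u r hs hu hr qs qu qr tr ss su sr hψ
    obtain ⟨v, hv⟩ := hs.exists_prod (by rw [qs]; omega)
    obtain ⟨w, hw⟩ := hu.exists_prod (by rw [qu]; omega)
    rcases hr.split qr tr with h | ⟨h, -⟩
    · obtain ⟨a, c, -, hc⟩ := single _ _ _ h hψ
      simp only [hv, hw, qs, qu] at hc
      exact hc.not_isTwoProducts (isTwoProducts_contr v w a c)
    · omega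
  -- With at most 7 leaves, `s` splits off a qubit `b`. If `u` is a pair split, killing `b` leaves a
  -- contraction of `u`, which has a factor. If `u` splits off `a`, killing `a` leaves a contraction
  -- of `s`: it has the factor `b` if `b ≠ a`, and too few leaves if `b = a`.
  have double : ∀ s u : QTree 4, s.WellFormed → u.WellFormed → s.qubits = Finset.univ →
      u.qubits = Finset.univ → s.IsTensor → u.IsTensor → s.size ≤ 7 → s.size + u.size ≤ 15 →
      (∀ x, ψ x = s.amplitude x + u.amplitude x) → False := by
    intro s u hs hu qs qu ts tu ss su hψ
    rcases hs.split qs ts with h1 | ⟨h1, -⟩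
    · rcases hu.split qu tu with h2 | ⟨-, h2⟩
      · obtain ⟨a, c, hF, hc⟩ := single _ _ _ h2 (fun x => by rw [hψ, add_comm])
        have h1' := h1
        obtain ⟨b, v, t, hwt, hqt, hst, hf⟩ := h1
        by_cases hba : b = a
        · subst hba
          have e : s.amplitude = fun x => v (x b) * t.amplitude x := funext hf
          rw [e] at hc
          exact not_isWClass_contr_of_size_lt hwt hqt (by omega) c hc
        · exact (isSingleSplit_hasFactor hqt hf).not_isWClass_contr hba c hc
      · obtain ⟨a, c, -, hc⟩ := single _ _ _ h1 hψ
        exact h2.not_isWClass_contr a c hc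
    · omega
  rcases hw.isTensor_or (by rw [hq]; simp) with htt | ⟨s, r, ts, ws, wr, qs, qr, sz, amp⟩
  · rcases hw.split hq htt with h1 | ⟨-, h1⟩
    · obtain ⟨a, c, -, hc⟩ := single _ _ (fun _ => 0) h1 (fun x => by rw [hψ, add_zero])
      refine hc.not_hasFactor 0 ⟨0, fun _ => 0, fun _ _ => rfl, fun x => by simp [contr]⟩
    · exact h1.not_isWClass_contr 0 _ (hψ ▸ hW 0 _ hne)
  · rw [hq] at qs qr
    have c1 := s.card_qubits_le_size
    rw [qs] at c1
    rcases wr.isTensor_or (by rw [qr]; simp) with tr | ⟨u, r', tu, wu, wr', qu, qr', sz', amp'⟩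
    · by_cases hs : s.size ≤ 7
      · exact double s r ws wr qs qr ts tr hs (by omega) (fun x => by rw [← hψ, amp])
      · exact double r s wr ws qr qs tr ts (by omega) (by omega)
          (fun x => by rw [← hψ, amp, add_comm])
    · rw [qr] at qu qr'
      have c2 := u.card_qubits_le_size
      have c3 := r'.card_qubits_le_size
      rw [qu] at c2
      rw [qr'] at c3
      -- Four summands on four qubits would already need 16 leaves.
      have tr' : r'.IsTensor := by
        rcases wr'.isTensor_or (by rw [qr']; simp) with h | ⟨u', r'', -, -, -, qu', qr'', sz'', -⟩
        · exact h
        · have c4 := u'.card_qubits_le_size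
          have c5 := r''.card_qubits_le_size
          rw [qu', qr'] at c4
          rw [qr'', qr'] at c5
          omega
      have hsum : ∀ x, ψ x = s.amplitude x + (u.amplitude x + r'.amplitude x) := fun x => by
        rw [← hψ, amp, amp']
      rcases (show s.size ≤ 5 ∧ u.size ≤ 5 ∧ r'.size ≤ 7 ∨ s.size ≤ 5 ∧ r'.size ≤ 5 ∧ u.size ≤ 7 ∨
        u.size ≤ 5 ∧ r'.size ≤ 5 ∧ s.size ≤ 7 by omega) with ⟨a1, a2, a3⟩ | ⟨a1, a2, a3⟩ | ⟨a1, a2, a3⟩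
      · exact triple s u r' ws wu wr' qs qu qr' tr' a1 a2 a3 (fun x => by rw [hsum]; ring)
      · exact triple s r' u ws wr' wu qs qr' qu tu a1 a2 a3 (fun x => by rw [hsum]; ring)
      · exact triple u r' s wu wr' ws qu qr' qs ts a1 a2 a3 hsum

/-! ### Construction of small trees -/

open QTree in
/-- A tree with four leaves for an arbitrary vector of two qubits. -/
def pairTree {n : ℕ} (i j : Fin n) (f : Fin 2 → Fin 2 → ℂ) : QTree n :=
  plus (tensor (leaf i ![1, 0]) (leaf j (f 0))) (tensor (leaf i ![0, 1]) (leaf j (f 1)))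

theorem pairTree_qubits {n : ℕ} (i j : Fin n) (f : Fin 2 → Fin 2 → ℂ) :
    (pairTree i j f).qubits = {i, j} := by
  simp [pairTree, QTree.qubits]

theorem pairTree_wellFormed {n : ℕ} {i j : Fin n} (h : i ≠ j) (f : Fin 2 → Fin 2 → ℂ) :
    (pairTree i j f).WellFormed := by
  simp [pairTree, QTree.WellFormed, QTree.qubits, h]

theorem pairTree_amplitude {n : ℕ} (i j : Fin n) (f : Fin 2 → Fin 2 → ℂ) (x : Fin n → Fin 2) :
    (pairTree i j f).amplitude x = f (x i) (x j) := by
  simp only [pairTree, QTree.amplitude]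
  generalize x i = a
  fin_cases a <;> simp

/-- `ψ` has a tree with at most `k` leaves. -/
def HasTree {n : ℕ} (ψ : QState n) (k : ℕ) : Prop := ∃ t : QTree n, t.Describes ψ ∧ t.size ≤ k

theorem HasTree.mono {n : ℕ} {ψ : QState n} {k k' : ℕ} (h : HasTree ψ k) (hk : k ≤ k') :
    HasTree ψ k' := by
  obtain ⟨t, ht, hs⟩ := h
  exact ⟨t, ht, hs.trans hk⟩

theorem HasTree.treeSize_le {n : ℕ} {ψ : QState n} {k : ℕ} (h : HasTree ψ k) :
    treeSize ψ ≤ k := by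
  obtain ⟨t, ht, hs⟩ := h
  exact iInf₂_le_of_le t ht (by exact_mod_cast hs)

open QTree in
theorem HasFactor.hasTree {φ : QState 3} {i : Fin 3} (h : HasFactor i φ) : HasTree φ 5 := by
  have hpair : ∀ (i j k : Fin 3) (v : Fin 2 → ℂ) (g : Fin 2 → Fin 2 → ℂ), i ≠ j → i ≠ k → j ≠ k →
      (∀ x, φ x = v (x i) * g (x j) (x k)) → HasTree φ 5 := by
    intro i j k v g hij hik hjk hφ
    refine ⟨tensor (leaf i v) (pairTree j k g), ⟨⟨trivial, pairTree_wellFormed hjk g, ?_⟩, ?_, ?_⟩,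
      le_rfl⟩
    · simp [pairTree_qubits, qubits, hij, hik]
    · simp only [qubits, pairTree_qubits]
      refine Finset.eq_univ_of_card _ ?_
      rw [Finset.card_union_of_disjoint (by simp [hij, hik]), Finset.card_pair hjk]
      rfl
    · ext x
      simp only [amplitude, pairTree_amplitude, hφ]
  fin_cases i
  · obtain ⟨v, g, h⟩ := (hasFactor_zero_iff φ).1 h
    exact hpair 0 1 2 v g (by decide) (by decide) (by decide) fun x => by rw [← h, vec3_eta]
  · obtain ⟨v, g, h⟩ := (hasFactor_one_iff φ).1 h
    exact hpair 1 0 2 v g (by decide) (by decide) (by decide) fun x => by rw [← h, vec3_eta]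
  · obtain ⟨v, g, h⟩ := (hasFactor_two_iff φ).1 h
    exact hpair 2 0 1 v g (by decide) (by decide) (by decide) fun x => by rw [← h, vec3_eta]

open QTree in
theorem IsTwoProducts.hasTree {φ : QState 3} (h : IsTwoProducts φ) : HasTree φ 6 := by
  obtain ⟨p, q, r, p', q', r', h⟩ := h
  refine ⟨plus (tensor (leaf 0 p) (tensor (leaf 1 q) (leaf 2 r)))
    (tensor (leaf 0 p') (tensor (leaf 1 q') (leaf 2 r'))), ⟨?_, ?_, ?_⟩, le_rfl⟩
  · simp [WellFormed, qubits]
  · simp only [qubits]; decide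
  · ext x
    rw [← vec3_eta x, h]
    simp [amplitude]; ring

-- The two terms with base point `p` share its leaf, which saves one leaf out of nine.
open QTree in
theorem IsTangent.hasTree {φ : QState 3} (h : IsTangent φ) : HasTree φ 8 := by
  obtain ⟨p, u, q, v, r, w, -, -, -, h⟩ := h
  refine ⟨plus (tensor (leaf 0 u) (tensor (leaf 1 q) (leaf 2 r)))
    (tensor (leaf 0 p) (plus (tensor (leaf 1 v) (leaf 2 r)) (tensor (leaf 1 q) (leaf 2 w)))),
    ⟨?_, ?_, ?_⟩, le_rfl⟩
  · simp [WellFormed, qubits]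
  · simp only [qubits]; decide
  · ext x
    rw [← vec3_eta x, h]
    simp [amplitude]; ring

theorem hasTree_three (φ : QState 3) : HasTree φ 8 := by
  by_cases h : hyperdet φ = 0
  · rcases isWClass_or_hasFactor_of_hyperdet h with h | ⟨i, h⟩
    · exact ((isWClass_iff_isTangent φ).1 h).hasTree
    · exact h.hasTree.mono (by norm_num)
  · exact (isTwoProducts_of_hyperdet h).hasTree.mono (by norm_num)

open QTree in
/-- Trees for the two components of `ψ` in a basis of qubit `a` give a tree for `ψ`. -/
theorem hasTree_of_contr {n : ℕ} {ψ : QState (n + 1)} (a : Fin (n + 1)) {k l : Fin 2 → ℂ}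
    (hkl : det2 k l = 1) {s s' : ℕ} (hk : HasTree (contr a k ψ) s)
    (hl : HasTree (contr a l ψ) s') : HasTree ψ (s + s' + 2) := by
  obtain ⟨t, ⟨hw, hq, hamp⟩, hs⟩ := hk
  obtain ⟨t', ⟨hw', hq', hamp'⟩, hs'⟩ := hl
  have hinj : Function.Injective a.succAbove := Fin.succAbove_right_injective
  have himg : Finset.univ.image a.succAbove = {a}ᶜ := by
    ext i
    simp
  refine ⟨plus (tensor (leaf a ![l 1, -l 0]) (t.map a.succAbove))
    (tensor (leaf a ![-k 1, k 0]) (t'.map a.succAbove)), ⟨⟨⟨trivial, hw.map hinj.injOn, ?_⟩,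
      ⟨trivial, hw'.map hinj.injOn, ?_⟩, ?_⟩, ?_, ?_⟩, ?_⟩
  · simp [qubits, qubits_map, hq, himg]
  · simp [qubits, qubits_map, hq', himg]
  · simp only [qubits, qubits_map, hq, hq']
  · simp only [qubits, qubits_map, hq, hq', himg, Finset.union_compl, Finset.union_self]
  · ext x
    simp only [amplitude, amplitude_map, hamp, hamp']
    have e : ∀ b, Fin.insertNth (α := fun _ => Fin 2) a b (fun i => x (a.succAbove i)) =
        Function.update x a b := fun b => Fin.insertNth_removeNth a b x
    simp only [contr, Fin.sum_univ_two, e]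
    have hx : ψ x = ψ (Function.update x a (x a)) := by rw [Function.update_eq_self]
    simp only [det2] at hkl
    rw [hx]
    generalize x a = b
    fin_cases b
    · simp; linear_combination ψ (Function.update x a 0) * hkl
    · simp; linear_combination ψ (Function.update x a 1) * hkl
  · simp only [size, size_map]; omega

/-- If the bad contraction has a factor, the cost is 5 + 8 + 2. Otherwise it is a sum of two
products, and a multiple of `k` added to `l` makes the other contraction one too, for 6 + 6 + 2. -/
theorem hasTree_of_not_irreducible {ψ : QState 4} (h : ¬ HasIrreducibleForm ψ) :
    HasTree ψ 15 := by
  rw [hasIrreducibleForm_iff] at h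
  push Not at h
  obtain ⟨a, k, hk, hW⟩ := h
  obtain ⟨l, hkl⟩ := exists_det2_eq_one hk
  by_cases hd : hyperdet (contr a k ψ) = 0
  · obtain ⟨i, hi⟩ := (isWClass_or_hasFactor_of_hyperdet hd).resolve_left hW
    exact hasTree_of_contr a hkl hi.hasTree (hasTree_three _)
  · obtain ⟨z, hz⟩ := exists_hyperdet_ne_zero (contr a l ψ) _ hd
    have e : contr a (fun i => l i + z * k i) ψ = fun x => contr a l ψ x + z * contr a k ψ x := by
      ext x
      simp only [contr, Fin.sum_univ_two]; ring
    rw [← e] at hz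
    refine (hasTree_of_contr a (l := fun i => l i + z * k i) ?_ (isTwoProducts_of_hyperdet hd).hasTree
      (isTwoProducts_of_hyperdet hz).hasTree).mono (by norm_num)
    simp only [det2] at hkl ⊢
    linear_combination hkl

open QTree in
theorem HasIrreducibleForm.hasTree {ψ : QState 4} (h : HasIrreducibleForm ψ) : HasTree ψ 16 := by
  obtain ⟨f, g, f', g', h⟩ := h.exists_pairs
  refine ⟨plus (tensor (pairTree 0 1 f) (pairTree 2 3 g))
    (tensor (pairTree 0 2 f') (pairTree 1 3 g')), ⟨⟨⟨pairTree_wellFormed (by decide) _,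
      pairTree_wellFormed (by decide) _, ?_⟩, ⟨pairTree_wellFormed (by decide) _,
      pairTree_wellFormed (by decide) _, ?_⟩, ?_⟩, ?_, ?_⟩, le_rfl⟩
  · simp only [pairTree_qubits]; decide
  · simp only [pairTree_qubits]; decide
  · simp only [qubits, pairTree_qubits]; decide
  · simp only [qubits, pairTree_qubits]; decide
  · ext x
    simp only [amplitude, pairTree_amplitude]
    rw [← vec4_eta x, h]
    rfl

/-! ### The maximal tree size -/

theorem HasIrreducibleForm.treeSize_eq {ψ : QState 4} (h : HasIrreducibleForm ψ) :
    treeSize ψ = 16 :=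
  le_antisymm h.hasTree.treeSize_le
    (le_iInf₂ fun t ht => by exact_mod_cast h.le_size ht)

theorem treeSize_le_of_not_irreducible {ψ : QState 4} (h : ¬ HasIrreducibleForm ψ) :
    treeSize ψ ≤ 15 :=
  (hasTree_of_not_irreducible h).treeSize_le

theorem treeSize_four_le (ψ : QState 4) : treeSize ψ ≤ 16 := by
  by_cases h : HasIrreducibleForm ψ
  · exact h.treeSize_eq.le
  · exact (treeSize_le_of_not_irreducible h).trans (by norm_num)

theorem psiFour_ne_zero : psiFour ≠ 0 := by
  intro h
  have := psiFour_norm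
  simp [h] at this

theorem mainTheorem3 :
    (∀ ψ : QState 4, ψ ≠ 0 →
      ((∀ φ : QState 4, φ ≠ 0 → treeSize φ ≤ treeSize ψ) ↔ HasIrreducibleForm ψ)) ∧
    IsGreatest (treeSize '' {ψ : QState 4 | ψ ≠ 0}) 16 ∧
    (∑ x, ‖psiFour x‖ ^ 2 = 1) ∧ treeSize psiFour = 16 := by
  have h4 := psiFour_hasIrreducibleForm.treeSize_eq
  refine ⟨fun ψ _ => ⟨fun h => ?_, fun h φ _ => ?_⟩, ⟨⟨psiFour, psiFour_ne_zero, h4⟩, ?_⟩,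
    psiFour_norm, h4⟩
  · by_contra hi
    have := (h psiFour psiFour_ne_zero).trans (treeSize_le_of_not_irreducible hi)
    rw [h4] at this
    exact absurd this (by norm_num)
  · rw [h.treeSize_eq]
    exact treeSize_four_le φ
  · rintro _ ⟨φ, -, rfl⟩
    exact treeSize_four_le φ
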